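/- A complex Banach algebra $A$ is said to have the strong property $(\mathbb{B})$ with a constant $r>0$ if for every complex Banach space $X$, every bounded bilinear map $\varphi : A\times A\to X$ and every $\alpha\ge 0$ such that $$\|\varphi(a,b)\|\le \alpha\|a\|\|b\| \quad\text{whenever } a,b\in A,\ ab=0,$$ one has $$\|\varphi(ab,c)-\varphi(a,bc)\|\le r\,\alpha\,\|a\|\|b\|\|c\|\qquad (a,b,c\in A).$$ **Theorem.** (i) Every (not necessarily unital) C$^*$-algebra has the strong property $(\mathbb{B})$ with the constant $288\pi(1+\sqrt2)$. (ii) For every locally compact (Hausdorff) group $G$ with left Haar measure $\mu$, the group algebra $L^1(G)=L^1(G,\mu)$, with the convolution product $(f*g)(x)=\int_G f(y)\,g(y^{-1}x)\,d\mu(y)$ and the $L^1$-norm, has the strong property $(\mathbb{B})$ with the constant $288\pi(1+\sqrt2)$. -/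

import Mathlib

open MeasureTheory

universe u v w

/-- A complex Banach algebra `A` has the strong property (B) with constant `r > 0`: for every
complex Banach space `X`, every bounded bilinear `φ : A × A → X` and every `α ≥ 0`, if
`‖φ(a, b)‖ ≤ α ‖a‖ ‖b‖` whenever `a b = 0`, then
`‖φ(a b, c) - φ(a, b c)‖ ≤ r α ‖a‖ ‖b‖ ‖c‖` for all `a, b, c`. -/
def HasStrongPropertyB (A : Type u) [NonUnitalNormedRing A] [NormedSpace ℂ A]
    [IsScalarTower ℂ A A] [SMulCommClass ℂ A A] [CompleteSpace A] (r : ℝ) : Prop :=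
  0 < r ∧
    ∀ (X : Type w) [NormedAddCommGroup X] [NormedSpace ℂ X] [CompleteSpace X]
      (φ : A →L[ℂ] A →L[ℂ] X) (α : ℝ), 0 ≤ α →
      (∀ a b : A, a * b = 0 → ‖φ a b‖ ≤ α * ‖a‖ * ‖b‖) →
      ∀ a b c : A, ‖φ (a * b) c - φ a (b * c)‖ ≤ r * α * ‖a‖ * ‖b‖ * ‖c‖

/-- The underlying Banach space `L¹(G)` of the group algebra of `G`, where `μ` is a left Haar
measure on `G`. It is a type synonym of `Lp ℂ 1 μ` that carries convolution as its product. -/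
def L1GroupAlgebra {G : Type*} [MeasurableSpace G] (μ : Measure G) : Type _ := Lp ℂ 1 μ

namespace L1GroupAlgebra

noncomputable section

set_option linter.unusedSectionVars false

section Space

variable {G : Type*} [MeasurableSpace G] {μ : Measure G}

instance : NormedAddCommGroup (L1GroupAlgebra μ) :=
  inferInstanceAs (NormedAddCommGroup (Lp ℂ 1 μ))

instance : NormedSpace ℂ (L1GroupAlgebra μ) :=
  inferInstanceAs (NormedSpace ℂ (Lp ℂ 1 μ))

instance : CompleteSpace (L1GroupAlgebra μ) :=
  inferInstanceAs (CompleteSpace (Lp ℂ 1 μ))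

instance : CoeFun (L1GroupAlgebra μ) fun _ => G → ℂ :=
  ⟨fun f => ((show Lp ℂ 1 μ from f) : G → ℂ)⟩

theorem integrable_coe (f : L1GroupAlgebra μ) : Integrable (f : G → ℂ) μ :=
  L1.integrable_coeFn f

theorem norm_eq_integral (f : L1GroupAlgebra μ) : ‖f‖ = ∫ y, ‖f y‖ ∂μ :=
  L1.norm_eq_integral_norm f

theorem coe_add (f g : L1GroupAlgebra μ) : ⇑(f + g) =ᵐ[μ] fun x => f x + g x :=
  Lp.coeFn_add (p := 1) (μ := μ) f g

theorem coe_smul (c : ℂ) (f : L1GroupAlgebra μ) : ⇑(c • f) =ᵐ[μ] fun x => c * f x :=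
  Lp.coeFn_smul (p := 1) (μ := μ) c f

end Space

section Translation

variable {G : Type*} [Group G] [TopologicalSpace G] [IsTopologicalGroup G]
  [MeasurableSpace G] [BorelSpace G] {μ : Measure G} [μ.IsHaarMeasure]

/-- Left translation `(τ_y g)(x) = g (y⁻¹ x)`, a linear isometry of `L¹(G)`. -/
def translate (y : G) : L1GroupAlgebra μ →ₗᵢ[ℂ] L1GroupAlgebra μ :=
  Lp.compMeasurePreservingₗᵢ ℂ (y⁻¹ * ·) (measurePreserving_mul_left μ y⁻¹)

theorem translate_ae (y : G) (g : L1GroupAlgebra μ) :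
    translate y g =ᵐ[μ] fun x => g (y⁻¹ * x) :=
  Lp.coeFn_compMeasurePreserving (μ := μ) _ (measurePreserving_mul_left μ y⁻¹)

theorem translate_eq_smul (y : G) (g : L1GroupAlgebra μ) :
    translate y g = DomMulAct.mk y⁻¹ • (show Lp ℂ 1 μ from g) := rfl

theorem translate_mul (y z : G) (g : L1GroupAlgebra μ) :
    translate (y * z) g = translate y (translate z g) := by
  simp only [translate_eq_smul, mul_inv_rev, DomMulAct.mk_mul]
  exact mul_smul (DomMulAct.mk y⁻¹) (DomMulAct.mk z⁻¹) (show Lp ℂ 1 μ from g)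

end Translation

section Convolution

variable {G : Type*} [Group G] [TopologicalSpace G] [IsTopologicalGroup G]
  [LocallyCompactSpace G] [MeasurableSpace G] [BorelSpace G]
  {μ : Measure G} [μ.IsHaarMeasure] [μ.Regular]

theorem continuous_translate (g : L1GroupAlgebra μ) : Continuous fun y : G => translate y g := by
  have : Fact ((1 : ENNReal) ≠ ⊤) := ⟨ENNReal.one_ne_top⟩
  have h : Continuous fun y : G => (DomMulAct.mk y⁻¹) • (show Lp ℂ 1 μ from g) :=
    (DomMulAct.continuous_mk.comp continuous_inv).smul continuous_const
  exact h

/-- The integrand `y ↦ f(y) τ_y g` of a convolution is Bochner integrable. -/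
theorem integrable_smul_translate (f g : L1GroupAlgebra μ) :
    Integrable (fun y => f y • translate y g) μ := by
  have key : AEStronglyMeasurable (fun y => f y • translate y g) μ := by
    refine Integrable.induction
      (fun k : G → ℂ => AEStronglyMeasurable (fun y => k y • translate y g) μ)
      (fun c s hs hμs => ?_) (fun k l _ _ _ hk hl => ?_) ?_ (fun k l hkl _ hk => ?_)
      (integrable_coe f)
    · have hK : ∀ n : ℕ, ∃ K ⊆ s, IsCompact K ∧ IsClosed K ∧ μ (s \ K) < ((n : ENNReal) + 1)⁻¹ :=
        fun n => hs.exists_isCompact_isClosed_sdiff_lt hμs.ne (by simp)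
      choose K hKs hKc hKcl hKμ using hK
      have hnull : μ (s \ ⋃ n, K n) = 0 := by
        refine le_antisymm (ge_of_tendsto' ((Filter.tendsto_add_atTop_iff_nat 1).2
          ENNReal.tendsto_inv_nat_nhds_zero) fun n => ?_) bot_le
        refine (measure_mono (Set.sdiff_subset_sdiff_right (Set.subset_iUnion K n))).trans ?_
        simpa using (hKμ n).le
      have h1 : AEStronglyMeasurable (fun y => translate y g) (μ.restrict (⋃ n, K n)) :=
        aestronglyMeasurable_iUnion_iff.2 fun n =>
          (continuous_translate g).continuousOn.aestronglyMeasurable_of_isCompact (hKc n)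
            (hKcl n).measurableSet
      have h2 : μ.restrict (⋃ n, K n) = μ.restrict s :=
        Measure.restrict_congr_set ((LE.le.eventuallyLE (Set.iUnion_subset hKs)).antisymm
          (ae_le_set.2 hnull))
      rw [h2] at h1
      have h3 : (fun y => s.indicator (fun _ => c) y • translate y g)
          = s.indicator fun y => c • translate y g := by
        funext y
        by_cases hy : y ∈ s <;> simp [hy]
      rw [h3]
      exact (aestronglyMeasurable_indicator_iff hs).2 (h1.const_smul c)
    · simpa only [Pi.add_apply, add_smul] using! hk.add hl
    · refine IsSeqClosed.isClosed fun k l hk hkl => ?_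
      obtain ⟨ns, -, hns⟩ := (tendstoInMeasure_of_tendsto_Lp hkl).exists_seq_tendsto_ae
      refine aestronglyMeasurable_of_tendsto_ae Filter.atTop
        (f := fun n y => k (ns n) y • translate y g) (fun n => hk (ns n)) ?_
      filter_upwards [hns] with y hy
      exact hy.smul_const _
    · refine hk.congr ?_
      filter_upwards [hkl] with y hy
      rw [hy]
  exact ((integrable_coe f).norm.mul_const ‖g‖).mono' key
    (.of_forall fun y => by rw [norm_smul, LinearIsometry.norm_map])

/-- Convolution of `f, g ∈ L¹(G)` as an `L¹(G)`-valued Bochner integral: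
`f * g = ∫ f(y) τ_y g dμ(y)`, that is, `(f * g)(x) = ∫ f(y) g(y⁻¹ x) dμ(y)`. -/
instance : Mul (L1GroupAlgebra μ) :=
  ⟨fun f g => ∫ y, f y • translate y g ∂μ⟩

theorem mul_def (f g : L1GroupAlgebra μ) : f * g = ∫ y, f y • translate y g ∂μ := rfl

theorem conv_add (f g h : L1GroupAlgebra μ) : f * (g + h) = f * g + f * h := by
  simp only [mul_def, map_add, smul_add]
  exact integral_add (integrable_smul_translate f g) (integrable_smul_translate f h)

theorem add_conv (f g h : L1GroupAlgebra μ) : (f + g) * h = f * h + g * h := by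
  simp only [mul_def]
  rw [← integral_add (integrable_smul_translate f h) (integrable_smul_translate g h)]
  refine integral_congr_ae ?_
  filter_upwards [coe_add f g] with y hy
  rw [hy, add_smul]

theorem conv_smul (c : ℂ) (f g : L1GroupAlgebra μ) : f * (c • g) = c • (f * g) := by
  simp only [mul_def, map_smul, ← integral_smul]
  simp only [smul_comm c]

theorem smul_conv (c : ℂ) (f g : L1GroupAlgebra μ) : (c • f) * g = c • (f * g) := by
  simp only [mul_def, ← integral_smul]
  refine integral_congr_ae ?_
  filter_upwards [coe_smul c f] with y hy
  rw [hy, mul_smul]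

theorem norm_conv_le (f g : L1GroupAlgebra μ) : ‖f * g‖ ≤ ‖f‖ * ‖g‖ := by
  rw [mul_def, norm_eq_integral f, ← integral_mul_const]
  refine (norm_integral_le_integral_norm _).trans (le_of_eq ?_)
  simp only [norm_smul, LinearIsometry.norm_map]

/-- Right convolution `f ↦ f * h` as a bounded operator. -/
def convRight (h : L1GroupAlgebra μ) : L1GroupAlgebra μ →L[ℂ] L1GroupAlgebra μ :=
  LinearMap.mkContinuous
    { toFun := fun f => f * h
      map_add' := fun f g => add_conv f g h
      map_smul' := fun c f => smul_conv c f h } ‖h‖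
    fun f => (norm_conv_le f h).trans_eq (mul_comm _ _)

theorem translate_conv (y : G) (f g : L1GroupAlgebra μ) :
    translate y f * g = translate y (f * g) := by
  have h1 : translate y (f * g) = ∫ z, f z • translate (y * z) g ∂μ := by
    rw [mul_def]
    refine ((translate y).toContinuousLinearMap.integral_comp_comm
      (integrable_smul_translate f g)).symm.trans ?_
    refine integral_congr_ae (.of_forall fun z => ?_)
    simp [translate_mul]
  rw [h1, mul_def, ← integral_mul_left_eq_self _ y]
  refine integral_congr_ae ?_
  filter_upwards [(measurePreserving_mul_left μ y).quasiMeasurePreserving.ae (translate_ae y f)]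
    with z hz
  simp only [hz, inv_mul_cancel_left]

theorem conv_assoc (f g h : L1GroupAlgebra μ) : f * g * h = f * (g * h) := by
  have h1 : convRight h (f * g) = ∫ y, convRight h (f y • translate y g) ∂μ :=
    ((convRight h).integral_comp_comm (integrable_smul_translate f g)).symm
  refine h1.trans ?_
  rw [mul_def f]
  refine integral_congr_ae (.of_forall fun y => ?_)
  change (f y • translate y g) * h = f y • translate y (g * h)
  rw [smul_conv, translate_conv]

/-- `L¹(G)` with convolution is a Banach algebra. -/
instance : NonUnitalNormedRing (L1GroupAlgebra μ) :=
  { (inferInstance : NormedAddCommGroup (L1GroupAlgebra μ)),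
    (inferInstance : Mul (L1GroupAlgebra μ)) with
    left_distrib := conv_add
    right_distrib := add_conv
    zero_mul := fun f => (convRight f).map_zero
    mul_zero := fun f => by simp [mul_def]
    mul_assoc := conv_assoc
    norm_mul_le := norm_conv_le }

instance : IsScalarTower ℂ (L1GroupAlgebra μ) (L1GroupAlgebra μ) :=
  ⟨fun c f g => smul_conv c f g⟩

instance : SMulCommClass ℂ (L1GroupAlgebra μ) (L1GroupAlgebra μ) :=
  ⟨fun c f g => (conv_smul c f g).symm⟩

end Convolution

end

end L1GroupAlgebra

/-! The defect `φ (a * b) c - φ a (b * c)` is linear in `b`, so `b` is split into pieces that act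
invertibly and isometrically: unitaries of the unitization for a C⋆-algebra, point masses for
`L¹(G)`. For such a piece `u`, put `p n = a uⁿ` and `q n = uⁿ c`. Both sequences are bounded, `p n *
q m` depends only on `n + m`, and `φ (p 1) (q 0) - φ (p 0) (q 1)` must be bounded
(`norm_apply_sub_apply_le`).

Zero products come from Fourier series. Up to normalization, `|sin| + sin` and `sin (|sin| - sin)`
have product zero, so their coefficient sequences `F`, `H` have zero convolution and `(∑ F n • p n)
* (∑ H n • q n) = 0`. The hypothesis on `φ` bounds the corresponding value, also after `p n`, `q n`
are multiplied by the character `e^{inx}`. Averaging over `x` leaves `∑ F n H (-n) φ (p n) (q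
(-n))`. The factor `sin` in `H` makes `F n H (-n)` finitely supported, with values 1, -4, 6, -4, 1
(`exists_conv_eq_zero`).

Thus all fourth differences of `n ↦ φ (p n) (q (1 - n))`, with every step size, are at most `108 α P
Q`. Since the sequence is bounded, a doubling argument passes to first differences at the cost of a
factor `16 / 7` (`norm_sub_le_of_fourthDiff`). This gives 248 for one piece. Four unitaries with
weights `‖b‖ / 2` give 496, and integration against `b` in `L¹(G)` keeps 248; both lie below the
required constant. -/

namespace StrongPropertyB

noncomputable section

/-! ### Fourier coefficients of two functions with product zero -/

section Sequences

theorem hasSum_of_eq {ι E : Type*} [AddCommMonoid E] [TopologicalSpace E] {f g : ι → E} {x y : E}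
    (h : HasSum f x) (hf : ∀ n, g n = f n) (hx : y = x) : HasSum g y := by
  rw [hx, funext hf]
  exact h

/-- The reciprocals of the odd integers. -/
def oddInv (k : ℤ) : ℝ := 1 / (2 * k + 1)

theorem two_mul_add_one_ne_zero (k : ℤ) : (2 * k + 1 : ℝ) ≠ 0 := by
  have : (2 * k + 1 : ℤ) ≠ 0 := by omega
  exact_mod_cast this

theorem summable_oddInv_sq : Summable fun k => oddInv k ^ 2 := by
  have h := (Real.summable_one_div_int_add_rpow (1 / 2) 2).2 (by norm_num)
  refine (h.mul_left (1 / 4)).congr fun k => ?_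
  have h2 : (k + 1 / 2 : ℝ) ≠ 0 := by
    have := two_mul_add_one_ne_zero k
    contrapose! this
    linarith
  have h1 := two_mul_add_one_ne_zero k
  rw [Real.rpow_two, sq_abs, oddInv]
  have : (2 * k + 1 : ℝ) = 2 * (k + 1 / 2) := by ring
  rw [this]
  field_simp
  norm_num

theorem summable_oddInv_mul (d : ℤ) : Summable fun k => oddInv k * oddInv (k + d) := by
  have h1 := summable_oddInv_sq
  have h2 : Summable fun k => oddInv (k + d) ^ 2 := (Equiv.addRight d).summable_iff.2 h1
  refine Summable.of_norm_bounded (h1.add h2) fun k => ?_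
  rw [Real.norm_eq_abs, abs_le]
  constructor <;> nlinarith [sq_nonneg (oddInv k + oddInv (k + d)),
    sq_nonneg (oddInv k - oddInv (k + d)), sq_nonneg (oddInv k), sq_nonneg (oddInv (k + d))]

theorem oddInv_sub (k d : ℤ) :
    oddInv k - oddInv (k + d) = 2 * d * (oddInv k * oddInv (k + d)) := by
  have h1 := two_mul_add_one_ne_zero k
  have h2 := two_mul_add_one_ne_zero (k + d)
  simp only [oddInv]
  field_simp
  push_cast
  ring

theorem tendsto_oddInv_nat :
    Filter.Tendsto (fun n : ℕ => oddInv n) Filter.atTop (nhds 0) := by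
  have h : Filter.Tendsto (fun n : ℕ => (2 * n + 1 : ℝ)) Filter.atTop Filter.atTop :=
    Filter.tendsto_atTop_add_const_right _ _
      (tendsto_natCast_atTop_atTop.const_mul_atTop (by norm_num))
  simpa [oddInv] using! h.inv_tendsto_atTop

/-- The halves `k ≥ 0` and `k < 0` telescope separately, to `1` and `-1`. -/
theorem hasSum_oddInv_sub_succ : HasSum (fun k => oddInv k - oddInv (k + 1)) 0 := by
  have hs : Summable fun k => oddInv k - oddInv (k + 1) := by
    simp only [oddInv_sub]
    exact (summable_oddInv_mul 1).mul_left _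
  have h1 : HasSum (fun n : ℕ => oddInv n - oddInv (n + 1)) 1 := by
    refine (Summable.hasSum_iff_tendsto_nat
      (hs.comp_injective (i := ((↑) : ℕ → ℤ)) Nat.cast_injective)).2 ?_
    have : ∀ n : ℕ, ∑ i ∈ Finset.range n, (oddInv i - oddInv (i + 1)) = 1 - oddInv n := by
      intro n
      have := Finset.sum_range_sub' (fun i : ℕ => oddInv i) n
      simpa [oddInv] using! this
    simp only [Function.comp_def, this]
    simpa using! tendsto_oddInv_nat.const_sub 1
  have hneg : ∀ k : ℤ, oddInv (-(k + 1)) = -oddInv k := fun k => by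
    have h1 := two_mul_add_one_ne_zero k
    have h2 := two_mul_add_one_ne_zero (-(k + 1))
    simp only [oddInv]
    rw [← neg_div, div_eq_div_iff h2 h1]
    push_cast
    ring
  have h2 : HasSum (fun n : ℕ => oddInv (-(n + 1)) - oddInv (-(n + 1) + 1)) (-1) := by
    refine (Summable.hasSum_iff_tendsto_nat (hs.comp_injective
      (i := fun n : ℕ => (-(n + 1) : ℤ)) (fun a b h => by simpa using h))).2 ?_
    have : ∀ n : ℕ, ∑ i ∈ Finset.range n, (oddInv (-(i + 1)) - oddInv (-(i + 1) + 1))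
        = oddInv (-n) - 1 := by
      intro n
      have := Finset.sum_range_sub (fun i : ℕ => oddInv (-i)) n
      simpa [oddInv] using! this
    simp only [Function.comp_def, this]
    rw [← Filter.tendsto_add_atTop_iff_nat 1]
    have h3 : ∀ n : ℕ, oddInv (-((n + 1 : ℕ) : ℤ)) = -oddInv n := fun n => by
      rw [← hneg]; push_cast; rfl
    simp only [h3]
    simpa using! tendsto_oddInv_nat.neg.sub_const 1
  exact hasSum_of_eq (HasSum.of_nat_of_neg_add_one (f := fun k => oddInv k - oddInv (k + 1)) h1 h2)
    (fun _ => rfl) (by norm_num)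

theorem hasSum_oddInv_sub_nat (d : ℕ) : HasSum (fun k => oddInv k - oddInv (k + d)) 0 := by
  induction d with
  | zero => simp [hasSum_zero]
  | succ d ih =>
    have h := (Equiv.addRight (d : ℤ)).hasSum_iff.2 hasSum_oddInv_sub_succ
    refine hasSum_of_eq (ih.add h) (fun k => ?_) ?_
    · simp [add_assoc]
    · simp

/-- The sum of the squared reciprocals of the odd integers. -/
def oddInvSum : ℝ := ∑' k, oddInv k ^ 2

/-- For `d ≠ 0`, partial fractions turn the product into a difference divided by `2 d`, and the sum
telescopes. So distinct shifts of `oddInv` are orthogonal. -/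
theorem hasSum_oddInv_mul (d : ℤ) :
    HasSum (fun k => oddInv k * oddInv (k + d)) (if d = 0 then oddInvSum else 0) := by
  have key : ∀ d : ℕ, d ≠ 0 → HasSum (fun k => oddInv k * oddInv (k + d)) 0 := fun d hd => by
    have h := (hasSum_oddInv_sub_nat d).mul_left (1 / (2 * d : ℝ))
    refine hasSum_of_eq h (fun k => ?_) (by rw [mul_zero])
    rw [oddInv_sub]
    push_cast
    field_simp
  split_ifs with hd
  · subst hd
    simpa [sq, oddInvSum] using! summable_oddInv_sq.hasSum
  · obtain ⟨n, rfl | rfl⟩ := d.eq_nat_or_neg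
    · exact key n (by simpa using hd)
    · have h := (Equiv.addRight (-n : ℤ)).hasSum_iff.2 (key n (by simpa using hd))
      exact hasSum_of_eq h (fun k => by simp [mul_comm]) rfl

/-- Up to a factor, the Fourier coefficients of `|sin θ|` at the even frequencies `2 k`. -/
def evenCoeff (k : ℤ) : ℝ := 1 / (4 * k ^ 2 - 1)

theorem evenCoeff_eq (k : ℤ) : evenCoeff k = (oddInv (k - 1) - oddInv k) / 2 := by
  have h1 := two_mul_add_one_ne_zero k
  have h2 := two_mul_add_one_ne_zero (k - 1)
  have h3 : (4 * k ^ 2 - 1 : ℝ) = (2 * k + 1) * (2 * (k - 1 : ℤ) + 1) := by push_cast; ring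
  simp only [evenCoeff, oddInv, h3]
  field_simp
  push_cast
  ring

theorem evenCoeff_neg (k : ℤ) : evenCoeff (-k) = evenCoeff k := by simp [evenCoeff]

theorem hasSum_evenCoeff : HasSum evenCoeff 0 := by
  have h := ((Equiv.addRight (-1 : ℤ)).hasSum_iff.2 hasSum_oddInv_sub_succ).div_const 2
  refine hasSum_of_eq h (fun k => ?_) ?_
  · simp [evenCoeff_eq, sub_eq_add_neg]
  · simp

/-- Only the coefficient at `0`, equal to `-1`, is negative; changing its sign adds `2` to a sum
that is zero. -/
theorem hasSum_abs_evenCoeff : HasSum (fun k => |evenCoeff k|) 2 := by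
  have h := hasSum_evenCoeff.add (hasSum_ite_eq (0 : ℤ) (2 : ℝ))
  refine hasSum_of_eq h (fun k => ?_) ?_
  · split_ifs with hk
    · norm_num [hk, evenCoeff]
    · have : (1 : ℝ) ≤ (k : ℝ) ^ 2 := by
        have : 1 ≤ k ^ 2 := by have := sq_nonneg k; have := pow_ne_zero 2 hk; omega
        exact_mod_cast this
      rw [abs_of_nonneg, add_zero]
      exact div_nonneg zero_le_one (by linarith)
  · simp

/-- This reflects that `|sin|² = sin²` is a trigonometric polynomial. Writing each factor as a
difference of two `oddInv` terms leaves four shifted correlations. -/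
theorem hasSum_evenCoeff_conv (n : ℤ) :
    HasSum (fun k => evenCoeff k * evenCoeff (n - k))
      (if n = 0 then oddInvSum / 2 else if n = 1 ∨ n = -1 then -oddInvSum / 4 else 0) := by
  have h1 := (Equiv.addRight (-1 : ℤ)).hasSum_iff.2 (hasSum_oddInv_mul (-n))
  have h2 := (Equiv.addRight (-1 : ℤ)).hasSum_iff.2 (hasSum_oddInv_mul (1 - n))
  have h := (((h1.sub h2).sub (hasSum_oddInv_mul (-n - 1))).add
    (hasSum_oddInv_mul (-n))).div_const 4
  refine hasSum_of_eq h (fun k => ?_) ?_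
  · rw [show n - k = -(k - n) by ring, evenCoeff_neg, evenCoeff_eq, evenCoeff_eq]
    simp only [Function.comp_apply, Equiv.coe_addRight]
    rw [show k + -1 = k - 1 by ring, show k - 1 + -n = k - n - 1 by ring,
      show k - 1 + (1 - n) = k - n by ring, show k + (-n - 1) = k - n - 1 by ring,
      show k + -n = k - n by ring]
    ring
  · rcases eq_or_ne n 0 with rfl | h0
    · norm_num
      ring
    rcases eq_or_ne n 1 with rfl | h1
    · norm_num
    rcases eq_or_ne n (-1) with rfl | h2
    · norm_num
    · have e1 : 1 - n ≠ 0 := by omega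
      have e2 : -n - 1 ≠ 0 := by omega
      simp [h0, h1, h2, e1, e2]

/-- The exact value `π² / 4` is not needed. Half the sum equals `∑ evenCoeff k ^ 2`, which is at
least its term at `0` and at most `∑ |evenCoeff k| = 2`. -/
theorem oddInvSum_mem : 2 ≤ oddInvSum ∧ oddInvSum ≤ 4 := by
  have h : HasSum (fun k => evenCoeff k * evenCoeff (0 - k)) (oddInvSum / 2) := by
    simpa using! hasSum_evenCoeff_conv 0
  have e : ∀ k, evenCoeff k * evenCoeff (0 - k) = |evenCoeff k| ^ 2 := fun k => by
    rw [zero_sub, evenCoeff_neg, sq_abs, sq]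
  simp only [e] at h
  have h0 := le_hasSum h 0 fun k _ => sq_nonneg _
  have h1 : oddInvSum / 2 ≤ 2 := by
    refine hasSum_le (fun k => ?_) h hasSum_abs_evenCoeff
    have h3 : |evenCoeff k| ≤ 1 := by
      by_cases hk : k = 0
      · norm_num [hk, evenCoeff]
      · have : (1 : ℝ) ≤ (k : ℝ) ^ 2 := by
          have : 1 ≤ k ^ 2 := by have := sq_nonneg k; have := pow_ne_zero 2 hk; omega
          exact_mod_cast this
        rw [evenCoeff, abs_of_nonneg (div_nonneg zero_le_one (by linarith)),
          div_le_one (by linarith)]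
        linarith
    nlinarith [abs_nonneg (evenCoeff k)]
  norm_num [evenCoeff] at h0
  constructor <;> linarith

/-- Up to a factor, the Fourier coefficients of `|sin θ|`. -/
def absSinCoeff (n : ℤ) : ℂ := if Even n then -(evenCoeff (n / 2) : ℂ) else 0

/-- Up to a factor, the Fourier coefficients of `sin θ`. -/
def sinCoeff (n : ℤ) : ℂ := if n = 1 then 1 else if n = -1 then -1 else 0

theorem absSinCoeff_two_mul (k : ℤ) : absSinCoeff (2 * k) = -(evenCoeff k : ℂ) := by
  simp [absSinCoeff]

theorem absSinCoeff_of_not_even {n : ℤ} (h : ¬Even n) : absSinCoeff n = 0 := if_neg h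

theorem hasSum_iff_even {E : Type*} [AddCommMonoid E] [TopologicalSpace E] {f : ℤ → E} {x : E}
    (hf : ∀ n, ¬Even n → f n = 0) : HasSum (fun k => f (2 * k)) x ↔ HasSum f x :=
  Function.Injective.hasSum_iff (g := fun k : ℤ => 2 * k) (fun a b h => by simpa using h)
    fun n hn => hf n fun ⟨k, hk⟩ => hn ⟨k, by simp only; omega⟩

theorem hasSum_norm_absSinCoeff : HasSum (fun n => ‖absSinCoeff n‖) 2 := by
  rw [← hasSum_iff_even fun n hn => by simp [absSinCoeff_of_not_even hn]]
  simpa [absSinCoeff_two_mul] using! hasSum_abs_evenCoeff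

theorem hasSum_absSinCoeff_conv (n : ℤ) :
    HasSum (fun m => absSinCoeff m * absSinCoeff (n - m))
      (if n = 0 then (oddInvSum / 2 : ℂ) else
        if n = 2 ∨ n = -2 then -(oddInvSum / 4 : ℂ) else 0) := by
  rw [← hasSum_iff_even fun m hm => by simp [absSinCoeff_of_not_even hm]]
  by_cases hn : Even n
  · obtain ⟨j, rfl⟩ := hn.two_dvd
    have h := Complex.hasSum_ofReal.2 (hasSum_evenCoeff_conv j)
    refine hasSum_of_eq h (fun k => ?_) ?_
    · rw [← mul_sub, absSinCoeff_two_mul, absSinCoeff_two_mul]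
      push_cast
      ring
    · rcases eq_or_ne j 0 with rfl | h0
      · simp
      rcases eq_or_ne j 1 with rfl | h1
      · simp; ring
      rcases eq_or_ne j (-1) with rfl | h2
      · simp; ring
      · have e1 : 2 * j ≠ 2 := by omega
        have e2 : 2 * j ≠ -2 := by omega
        simp [h0, h1, h2, e1, e2]
  · have e : ∀ k : ℤ, absSinCoeff (n - 2 * k) = 0 := fun k =>
      absSinCoeff_of_not_even (by simpa [Int.even_sub] using hn)
    have h0 : n ≠ 0 := by rintro rfl; simp at hn
    have h1 : n ≠ 2 := by rintro rfl; exact hn even_two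
    have h2 : n ≠ -2 := by rintro rfl; exact hn (by decide)
    simp [e, h0, h1, h2, hasSum_zero]

theorem hasSum_sinCoeff_mul (g : ℤ → ℂ) : HasSum (fun m => sinCoeff m * g m) (g 1 - g (-1)) := by
  have h := (hasSum_ite_eq (1 : ℤ) (g 1)).sub (hasSum_ite_eq (-1 : ℤ) (g (-1)))
  refine hasSum_of_eq h (fun m => ?_) rfl
  rcases eq_or_ne m 1 with rfl | h1
  · simp [sinCoeff]
  rcases eq_or_ne m (-1) with rfl | h2
  · simp [sinCoeff]
  · simp [sinCoeff, h1, h2]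

theorem hasSum_mul_sinCoeff (g : ℤ → ℂ) (n : ℤ) :
    HasSum (fun m => g m * sinCoeff (n - m)) (g (n - 1) - g (n + 1)) := by
  have h := (Equiv.subLeft n).hasSum_iff.2 (hasSum_sinCoeff_mul fun m => g (n - m))
  refine hasSum_of_eq h (fun m => ?_) ?_
  · simp [mul_comm]
  · simp

theorem hasSum_norm_sinCoeff : HasSum (fun n => ‖sinCoeff n‖) 2 := by
  have h := (hasSum_ite_eq (1 : ℤ) (1 : ℝ)).add (hasSum_ite_eq (-1 : ℤ) (1 : ℝ))
  refine hasSum_of_eq h (fun m => ?_) ?_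
  · rcases eq_or_ne m 1 with rfl | h1
    · simp [sinCoeff]
    rcases eq_or_ne m (-1) with rfl | h2
    · simp [sinCoeff]
    · simp [sinCoeff, h1, h2]
  · norm_num

/-- This is `(s + c t) (s - c t) = s² - c² t²` for `s` and `t` proportional to `|sin|` and `sin`.
The value of `c²` is the one that makes the squares cancel. -/
theorem hasSum_conv_sinCoeff {c : ℂ} (hc : c ^ 2 = -(oddInvSum / 4 : ℂ)) (n : ℤ) :
    HasSum (fun m => (absSinCoeff m + c * sinCoeff m) *
      (absSinCoeff (n - m) - c * sinCoeff (n - m))) 0 := by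
  have h := ((hasSum_absSinCoeff_conv n).add
    (((hasSum_sinCoeff_mul fun m => absSinCoeff (n - m)).sub
      (hasSum_mul_sinCoeff absSinCoeff n)).mul_left c)).sub
    ((hasSum_mul_sinCoeff sinCoeff n).mul_left (c ^ 2))
  refine hasSum_of_eq h (fun m => ?_) ?_
  · ring
  · rw [hc, sub_neg_eq_add n 1, sub_self, mul_zero, add_zero]
    rcases eq_or_ne n 0 with rfl | h0
    · norm_num [sinCoeff]
      ring
    rcases eq_or_ne n 2 with rfl | h1
    · norm_num [sinCoeff]
    rcases eq_or_ne n (-2) with rfl | h2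
    · norm_num [sinCoeff]
    · have e1 : n - 1 ≠ 1 := by omega
      have e2 : n - 1 ≠ -1 := by omega
      have e3 : n + 1 ≠ 1 := by omega
      have e4 : n + 1 ≠ -1 := by omega
      simp [sinCoeff, h0, h1, h2, e1, e2, e3, e4]

/-- The coefficients of `(w - 1) ^ 4 / w ^ 2`. -/
def fourthDiffCoeff (n : ℤ) : ℂ :=
  if n = 0 then 6 else if n = 1 ∨ n = -1 then -4 else if n = 2 ∨ n = -2 then 1 else 0

/-- Two summable sequences with zero convolution (the Fourier coefficients of continuous functions
with disjoint supports) such that the cross-correlation of the two functions is, up to a power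
of `w`, the polynomial `(w - 1) ^ 4`. -/
theorem exists_conv_eq_zero : ∃ F H : ℤ → ℂ,
    Summable (fun n => ‖F n‖) ∧ Summable (fun n => ‖H n‖) ∧
    (∑' n, ‖F n‖) * (∑' n, ‖H n‖) ≤ 108 ∧
    (∀ n, HasSum (fun m => F m * H (n - m)) 0) ∧
    ∀ n, F n * H (-n) = fourthDiffCoeff n := by
  obtain ⟨hl, hu⟩ := oddInvSum_mem
  set r : ℝ := √oddInvSum / 2 with hr
  have hr2 : r ^ 2 = oddInvSum / 4 := by
    rw [hr, div_pow, Real.sq_sqrt (by linarith)]; norm_num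
  have hr0 : 0 ≤ r := by positivity
  have hr1 : 1 / 2 ≤ r := by nlinarith
  have hr3 : r ≤ 1 := by nlinarith
  set c : ℂ := Complex.I * r with hcdef
  have hc : c ^ 2 = -(oddInvSum / 4 : ℂ) := by
    rw [hcdef, mul_pow, Complex.I_sq, ← Complex.ofReal_pow, hr2]; push_cast; ring
  have hcn : ‖c‖ = r := by simp [hcdef, abs_of_nonneg hr0]
  have hc0 : c ≠ 0 := by rw [← norm_pos_iff, hcn]; linarith
  set H0 : ℤ → ℂ := fun n => absSinCoeff n - c * sinCoeff n with hH0
  have hmaj : HasSum (fun n => ‖absSinCoeff n‖ + r * ‖sinCoeff n‖) (2 + r * 2) :=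
    hasSum_norm_absSinCoeff.add (hasSum_norm_sinCoeff.mul_left r)
  have hF0 : ∀ n, ‖absSinCoeff n + c * sinCoeff n‖ ≤ ‖absSinCoeff n‖ + r * ‖sinCoeff n‖ :=
    fun n => (norm_add_le _ _).trans_eq (by rw [norm_mul, hcn])
  have hH0' : ∀ n, ‖H0 n‖ ≤ ‖absSinCoeff n‖ + r * ‖sinCoeff n‖ :=
    fun n => (norm_sub_le _ _).trans_eq (by rw [norm_mul, hcn])
  have hmajH := ((Equiv.addRight (-1 : ℤ)).hasSum_iff.2 hmaj).add
    ((Equiv.addRight (1 : ℤ)).hasSum_iff.2 hmaj)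
  have hF1 : ∀ n, ‖3 / c * (absSinCoeff n + c * sinCoeff n)‖
      ≤ 3 / r * (‖absSinCoeff n‖ + r * ‖sinCoeff n‖) := fun n => by
    rw [norm_mul, norm_div, hcn]
    norm_num
    gcongr
    exact hF0 n
  have hH1 : ∀ n, ‖H0 (n - 1) - H0 (n + 1)‖ ≤
      (‖absSinCoeff (n + -1)‖ + r * ‖sinCoeff (n + -1)‖) +
      (‖absSinCoeff (n + 1)‖ + r * ‖sinCoeff (n + 1)‖) := fun n =>
    (norm_sub_le _ _).trans (add_le_add (hH0' _) (hH0' _))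
  have hmajF := hmaj.mul_left (3 / r)
  have sF := Summable.of_nonneg_of_le (fun _ => norm_nonneg _) hF1 hmajF.summable
  have sH := Summable.of_nonneg_of_le (fun _ => norm_nonneg _) hH1 hmajH.summable
  -- Passing from `H0` to `H0 (n - 1) - H0 (n + 1)` multiplies the function by a multiple of `sin`.
  -- This preserves the zero product and shifts parity, so that in `F n * H (-n)` each surviving
  -- term pairs `absSinCoeff` with the finitely supported `sinCoeff`. The factor `3 / c` normalizes
  -- the outer coefficients to `1`.
  refine ⟨fun n => 3 / c * (absSinCoeff n + c * sinCoeff n), fun n => H0 (n - 1) - H0 (n + 1),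
    sF, sH, ?_, fun n => ?_, fun n => ?_⟩
  · have b1 := hasSum_le hF1 sF.hasSum hmajF
    have b2 := hasSum_le hH1 sH.hasSum hmajH
    refine (mul_le_mul b1 b2 (tsum_nonneg fun _ => norm_nonneg _) (by positivity)).trans ?_
    -- On `1 / 2 ≤ r ≤ 1` this is largest at `r = 1 / 2`, where it equals 108.
    have e : 3 / r * (2 + r * 2) * (2 + r * 2 + (2 + r * 2)) = 24 * (1 + r) ^ 2 / r := by
      field_simp; ring
    rw [e, div_le_iff₀ (by linarith)]
    nlinarith
  · have h := (((hasSum_conv_sinCoeff hc (n - 1)).sub (hasSum_conv_sinCoeff hc (n + 1)))).mul_left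
      (3 / c)
    refine hasSum_of_eq h (fun m => ?_) ?_
    · simp only [hH0]
      rw [show n - m - 1 = n - 1 - m by ring, show n - m + 1 = n + 1 - m by ring]
      ring
    · simp
  · simp only [hH0]
    by_cases hn : Even n
    · have h1 : absSinCoeff (-n - 1) = 0 :=
        absSinCoeff_of_not_even (by simp [hn])
      have h2 : absSinCoeff (-n + 1) = 0 :=
        absSinCoeff_of_not_even (by simp [hn])
      have h3 : sinCoeff n = 0 := by
        have e1 : n ≠ 1 := by rintro rfl; simp at hn
        have e2 : n ≠ -1 := by rintro rfl; simp at hn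
        simp [sinCoeff, e1, e2]
      rw [h1, h2, h3]
      rcases eq_or_ne n 0 with rfl | h0
      · norm_num [absSinCoeff, sinCoeff, evenCoeff, fourthDiffCoeff]
        field_simp
        norm_num
      rcases eq_or_ne n 2 with rfl | h1
      · norm_num [absSinCoeff, sinCoeff, evenCoeff, fourthDiffCoeff]
        field_simp
      rcases eq_or_ne n (-2) with rfl | h2
      · norm_num [absSinCoeff, sinCoeff, evenCoeff, fourthDiffCoeff]
        field_simp
      · have e1 : -n - 1 ≠ 1 := by omega
        have e2 : -n - 1 ≠ -1 := by omega
        have e3 : -n + 1 ≠ 1 := by omega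
        have e4 : -n + 1 ≠ -1 := by omega
        have e5 : n ≠ 1 := by rintro rfl; simp at hn
        have e6 : n ≠ -1 := by rintro rfl; simp at hn
        simp [sinCoeff, fourthDiffCoeff, h0, h1, h2, e1, e2, e3, e4, e5, e6]
    · have h1 : sinCoeff (-n - 1) = 0 := by
        have e1 : -n - 1 ≠ 1 := fun h => hn ⟨-1, by omega⟩
        have e2 : -n - 1 ≠ -1 := fun h => hn ⟨0, by omega⟩
        simp [sinCoeff, e1, e2]
      have h2 : sinCoeff (-n + 1) = 0 := by
        have e1 : -n + 1 ≠ 1 := fun h => hn ⟨0, by omega⟩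
        have e2 : -n + 1 ≠ -1 := fun h => hn ⟨1, by omega⟩
        simp [sinCoeff, e1, e2]
      rw [h1, h2, absSinCoeff_of_not_even hn]
      rcases eq_or_ne n 1 with rfl | h1
      · norm_num [absSinCoeff, sinCoeff, evenCoeff, fourthDiffCoeff]
        field_simp
      rcases eq_or_ne n (-1) with rfl | h2
      · norm_num [absSinCoeff, sinCoeff, evenCoeff, fourthDiffCoeff]
        field_simp
      · have e0 : n ≠ 0 := fun h => hn ⟨0, by omega⟩
        have e1 : n ≠ 2 := fun h => hn ⟨1, by omega⟩
        have e2 : n ≠ -2 := fun h => hn ⟨-1, by omega⟩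
        simp [sinCoeff, fourthDiffCoeff, h1, h2, e0, e1, e2]

end Sequences

end

end StrongPropertyB

namespace StrongPropertyB

noncomputable section

/-! ### Double series and averaging over the circle -/

section Averaging

open AddCircle

variable {X : Type*} [NormedAddCommGroup X] [NormedSpace ℂ X]

theorem summable_norm_smul {ι : Type*} {F : ι → ℂ} (hF : Summable fun n => ‖F n‖) {p : ι → X}
    {P : ℝ} (hp : ∀ n, ‖p n‖ ≤ P) : Summable fun n => ‖F n • p n‖ :=
  Summable.of_nonneg_of_le (fun _ => norm_nonneg _)
    (fun n => by rw [norm_smul]; exact mul_le_mul_of_nonneg_left (hp n) (norm_nonneg _))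
    (hF.mul_right P)

theorem norm_tsum_smul_le {ι : Type*} {F : ι → ℂ} (hF : Summable fun n => ‖F n‖) {p : ι → X}
    {P : ℝ} (hp : ∀ n, ‖p n‖ ≤ P) : ‖∑' n, F n • p n‖ ≤ (∑' n, ‖F n‖) * P := by
  rw [← tsum_mul_right]
  exact tsum_of_norm_bounded (hF.mul_right P).hasSum fun n => by
    rw [norm_smul]; exact mul_le_mul_of_nonneg_left (hp n) (norm_nonneg _)

theorem summable_norm_mul_prod {F H : ℤ → ℂ} (hF : Summable fun n => ‖F n‖)
    (hH : Summable fun n => ‖H n‖) : Summable fun z : ℤ × ℤ => ‖F z.1 * H z.2‖ := by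
  simp only [norm_mul]
  exact hF.mul_of_nonneg hH (fun _ => norm_nonneg _) fun _ => norm_nonneg _

theorem norm_apply_le_of_le {A : Type*} [NormedAddCommGroup A] [NormedSpace ℂ A]
    (φ : A →L[ℂ] A →L[ℂ] X) {a b : A} {P Q : ℝ} (ha : ‖a‖ ≤ P)
    (hb : ‖b‖ ≤ Q) : ‖φ a b‖ ≤ ‖φ‖ * P * Q := by
  have := (norm_nonneg a).trans ha
  refine (φ.le_opNorm₂ a b).trans ?_
  gcongr

theorem apply_tsum_tsum {A : Type*} [NormedAddCommGroup A] [NormedSpace ℂ A] [CompleteSpace A]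
    [CompleteSpace X] (φ : A →L[ℂ] A →L[ℂ] X) {F H : ℤ → ℂ} (hF : Summable fun n => ‖F n‖)
    (hH : Summable fun n => ‖H n‖) {p q : ℤ → A} {P Q : ℝ} (hp : ∀ n, ‖p n‖ ≤ P)
    (hq : ∀ n, ‖q n‖ ≤ Q) :
    φ (∑' n, F n • p n) (∑' n, H n • q n) = ∑' z : ℤ × ℤ, (F z.1 * H z.2) • φ (p z.1) (q z.2) := by
  have hb : ∀ z : ℤ × ℤ, ‖φ (p z.1) (q z.2)‖ ≤ ‖φ‖ * P * Q := fun z =>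
    norm_apply_le_of_le φ (hp _) (hq _)
  rw [Summable.tsum_prod (summable_norm_smul (summable_norm_mul_prod hF hH) hb).of_norm]
  have h1 := (summable_norm_smul hF hp).of_norm.hasSum.mapL (φ.flip (∑' n, H n • q n))
  refine h1.tsum_eq.symm.trans (tsum_congr fun n => ?_)
  have h2 := (summable_norm_smul hH hq).of_norm.hasSum.mapL (φ (F n • p n))
  refine h2.tsum_eq.symm.trans (tsum_congr fun m => ?_)
  simp [mul_smul, smul_comm (F n)]

theorem tsum_prod_eq_zero {X : Type*} [NormedAddCommGroup X] [CompleteSpace X] {f : ℤ × ℤ → X}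
    (hf : Summable f) (h : ∀ n, ∑' m, f (m, n - m) = 0) : ∑' z, f z = 0 := by
  let e : ℤ × ℤ ≃ ℤ × ℤ :=
    { toFun := fun z => (z.2, z.1 - z.2)
      invFun := fun z => (z.1 + z.2, z.1)
      left_inv := fun z => by simp
      right_inv := fun z => by simp }
  have hfe : Summable fun z : ℤ × ℤ => f (z.2, z.1 - z.2) := e.summable_iff.2 hf
  have hprod := hfe.tsum_prod
  simp only [h, tsum_zero] at hprod
  rw [← hprod]
  exact (e.tsum_eq f).symm

/-- On each antidiagonal the products `p m * q (n - m)` share the value `r n`, whose total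
coefficient is the convolution of `F` and `H` at `n`. -/
theorem tsum_smul_mul_tsum_smul_eq_zero {A : Type*} [NonUnitalNormedRing A] [NormedSpace ℂ A]
    [IsScalarTower ℂ A A] [SMulCommClass ℂ A A] [CompleteSpace A] {F H : ℤ → ℂ}
    (hF : Summable fun n => ‖F n‖) (hH : Summable fun n => ‖H n‖)
    (hFH : ∀ n, HasSum (fun m => F m * H (n - m)) 0) {p q r : ℤ → A} {P Q : ℝ}
    (hp : ∀ n, ‖p n‖ ≤ P) (hq : ∀ n, ‖q n‖ ≤ Q) (hpq : ∀ n m, p n * q m = r (n + m)) :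
    (∑' n, F n • p n) * (∑' n, H n • q n) = 0 := by
  have h := apply_tsum_tsum (ContinuousLinearMap.mul ℂ A) hF hH hp hq
  simp only [ContinuousLinearMap.mul_apply', hpq] at h
  rw [h]
  refine tsum_prod_eq_zero ?_ fun n => ?_
  · have hr : ∀ z : ℤ × ℤ, ‖r (z.1 + z.2)‖ ≤ P * Q := fun z => by
      rw [← hpq]
      exact norm_mul_le_of_le (hp _) (hq _)
    exact (summable_norm_smul (summable_norm_mul_prod hF hH) hr).of_norm
  · simp only [add_sub_cancel]
    rw [((hFH n).smul_const (r n)).tsum_eq, zero_smul]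

theorem integral_fourier (n : ℤ) :
    ∫ x : UnitAddCircle, fourier n x ∂haarAddCircle = if n = 0 then 1 else 0 := by
  have h := congrFun (fourierCoeff_fourier (T := 1) n) 0
  simp only [fourierCoeff, neg_zero, fourier_zero, one_smul] at h
  rw [h]
  simp [Pi.single_apply, eq_comm]

/-- Integrating over `x` kills every term with `z.1 + z.2 ≠ 0`, and Haar measure has mass one, so
the uniform bound survives. -/
theorem norm_tsum_antidiagonal_le [CompleteSpace X] {F H : ℤ → ℂ} (hF : Summable fun n => ‖F n‖)
    (hH : Summable fun n => ‖H n‖) {B : ℤ → ℤ → X} {M K : ℝ} (hB : ∀ n m, ‖B n m‖ ≤ M)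
    (h : ∀ x : UnitAddCircle,
      ‖∑' z : ℤ × ℤ, (F z.1 * H z.2 * fourier (z.1 + z.2) x) • B z.1 z.2‖ ≤ K) :
    ‖∑' n, (F n * H (-n)) • B n (-n)‖ ≤ K := by
  have hs := summable_norm_mul_prod hF hH
  have hinteg : ∀ z : ℤ × ℤ, Integrable (fun x : UnitAddCircle =>
      (F z.1 * H z.2 * fourier (z.1 + z.2) x) • B z.1 z.2) haarAddCircle := fun z => by
    have hc : Continuous fun x : UnitAddCircle =>
      (F z.1 * H z.2 * fourier (z.1 + z.2) x) • B z.1 z.2 := by fun_prop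
    exact hc.integrable_of_hasCompactSupport (HasCompactSupport.of_compactSpace _)
  have hnorm : ∀ (z : ℤ × ℤ) (x : UnitAddCircle),
      ‖(F z.1 * H z.2 * fourier (z.1 + z.2) x) • B z.1 z.2‖ = ‖(F z.1 * H z.2) • B z.1 z.2‖ :=
    fun z x => by rw [norm_smul, norm_smul, norm_mul _ (fourier _ x), fourier_apply,
      Circle.norm_coe, mul_one]
  have hsum := hasSum_integral_of_summable_integral_norm hinteg (by
    simp only [hnorm, integral_const, probReal_univ, one_smul]
    exact summable_norm_smul hs fun z => hB z.1 z.2)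
  have hval : ∀ z : ℤ × ℤ, ∫ x : UnitAddCircle, (F z.1 * H z.2 * fourier (z.1 + z.2) x) • B z.1 z.2
      ∂haarAddCircle = if z.1 + z.2 = 0 then (F z.1 * H z.2) • B z.1 z.2 else 0 := fun z => by
    rw [integral_smul_const, integral_const_mul, integral_fourier]
    split_ifs <;> simp
  simp only [hval] at hsum
  have hinj : Function.Injective fun n : ℤ => (n, -n) := fun a b hab => (Prod.ext_iff.1 hab).1
  rw [← hinj.hasSum_iff] at hsum
  · simp only [Function.comp_def, add_neg_cancel, if_true] at hsum
    rw [hsum.tsum_eq]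
    simpa using! norm_integral_le_of_norm_le_const (μ := (haarAddCircle : Measure UnitAddCircle))
      (Filter.Eventually.of_forall h)
  · rintro ⟨n, m⟩ hnm
    refine if_neg fun h0 => hnm ⟨n, ?_⟩
    simp only [Prod.mk.injEq, true_and]
    simp only at h0
    omega

end Averaging

/-! ### From fourth differences to first differences -/

section Differences

variable {X : Type*} [NormedAddCommGroup X] [NormedSpace ℂ X]

theorem norm_smul_le_norm_mul {x : X} {b : ℝ} (c : ℂ) (hx : ‖x‖ ≤ b) : ‖c • x‖ ≤ ‖c‖ * b := by
  rw [norm_smul]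
  gcongr

/-- The supremum `S` is finite by `hM` and satisfies `c S ≤ S + b`. -/
theorem le_div_of_doubling {f : ℤ → ℤ → ℝ} {M b c : ℝ} (hc : 1 < c) (hM : ∀ N j, f N j ≤ M)
    (h : ∀ N j, c * f N j ≤ f (2 * N) j + b) (N j : ℤ) : f N j ≤ b / (c - 1) := by
  have hb : BddAbove (Set.range fun z : ℤ × ℤ => f z.1 z.2) :=
    ⟨M, by rintro _ ⟨z, rfl⟩; exact hM _ _⟩
  have hle : ∀ N j, f N j ≤ ⨆ z : ℤ × ℤ, f z.1 z.2 := fun N j => le_ciSup hb (N, j)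
  refine (hle N j).trans ?_
  have : (⨆ z : ℤ × ℤ, f z.1 z.2) ≤ ((⨆ z : ℤ × ℤ, f z.1 z.2) + b) / c :=
    ciSup_le fun z => by
      rw [le_div_iff₀ (by linarith)]
      linarith [h z.1 z.2, hle (2 * z.1) z.2]
  rw [le_div_iff₀ (by linarith)] at this ⊢
  linarith

/-- A bounded sequence whose fourth differences of all step sizes are bounded by `B` has first
differences bounded by `16 B / 7`. -/
theorem norm_sub_le_of_fourthDiff {x : ℤ → X} {M B : ℝ} (hM : ∀ n, ‖x n‖ ≤ M)
    (hB : ∀ N j, ‖x (j + 4 * N) - (4 : ℂ) • x (j + 3 * N) + (6 : ℂ) • x (j + 2 * N)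
      - (4 : ℂ) • x (j + N) + x j‖ ≤ B) : ‖x 1 - x 0‖ ≤ 16 / 7 * B := by
  have h3 : ∀ N j, ‖x (j + 3 * N) - (3 : ℂ) • x (j + 2 * N) + (3 : ℂ) • x (j + N) - x j‖
      ≤ 12 * B / (8 - 1) := by
    refine le_div_of_doubling (M := 8 * M) (by norm_num) (fun N j => ?_) fun N j => ?_
    · refine (norm_sub_le_of_le (norm_add_le_of_le (norm_sub_le_of_le (hM _)
        (norm_smul_le_norm_mul _ (hM _))) (norm_smul_le_norm_mul _ (hM _))) (hM _)).trans ?_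
      norm_num
      linarith
    · have b0 := hB N j
      have b1 := hB N (j + N)
      have b2 := hB N (j + 2 * N)
      rw [show j + N + 4 * N = j + 5 * N by ring, show j + N + 3 * N = j + 4 * N by ring,
        show j + N + 2 * N = j + 3 * N by ring, show j + N + N = j + 2 * N by ring] at b1
      rw [show j + 2 * N + 4 * N = j + 6 * N by ring, show j + 2 * N + 3 * N = j + 5 * N by ring,
        show j + 2 * N + 2 * N = j + 4 * N by ring, show j + 2 * N + N = j + 3 * N by ring] at b2
      rw [show j + 3 * (2 * N) = j + 6 * N by ring, show j + 2 * (2 * N) = j + 4 * N by ring]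
      -- With `T` the shift by `N`, this is `(T² - 1)³ - 8 (T - 1)³ = (T - 1)⁴ (T² + 4 T + 7)`; the
      -- coefficients `1 + 4 + 7` give `12 B`.
      have e : (8 : ℂ) • (x (j + 3 * N) - (3 : ℂ) • x (j + 2 * N) + (3 : ℂ) • x (j + N) - x j) =
          (x (j + 6 * N) - (3 : ℂ) • x (j + 4 * N) + (3 : ℂ) • x (j + 2 * N) - x j)
          - (7 : ℂ) • (x (j + 4 * N) - (4 : ℂ) • x (j + 3 * N) + (6 : ℂ) • x (j + 2 * N)
            - (4 : ℂ) • x (j + N) + x j)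
          - (4 : ℂ) • (x (j + 5 * N) - (4 : ℂ) • x (j + 4 * N) + (6 : ℂ) • x (j + 3 * N)
            - (4 : ℂ) • x (j + 2 * N) + x (j + N))
          - (x (j + 6 * N) - (4 : ℂ) • x (j + 5 * N) + (6 : ℂ) • x (j + 4 * N)
            - (4 : ℂ) • x (j + 3 * N) + x (j + 2 * N)) := by module
      have e' := congrArg norm e
      rw [norm_smul, Complex.norm_ofNat] at e'
      rw [e']
      refine (norm_sub_le_of_le (norm_sub_le_of_le (norm_sub_le_of_le le_rfl
        (norm_smul_le_norm_mul _ b0)) (norm_smul_le_norm_mul _ b1)) b2).trans ?_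
      norm_num
      linarith
  have h2 : ∀ N j, ‖x (j + 2 * N) - (2 : ℂ) • x (j + N) + x j‖
      ≤ 4 * (12 * B / (8 - 1)) / (4 - 1) := by
    refine le_div_of_doubling (M := 4 * M) (by norm_num) (fun N j => ?_) fun N j => ?_
    · refine (norm_add_le_of_le (norm_sub_le_of_le (hM _)
        (norm_smul_le_norm_mul _ (hM _))) (hM _)).trans ?_
      norm_num
      linarith
    · have b0 := h3 N j
      have b1 := h3 N (j + N)
      rw [show j + N + 3 * N = j + 4 * N by ring,
        show j + N + 2 * N = j + 3 * N by ring, show j + N + N = j + 2 * N by ring] at b1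
      rw [show j + 2 * (2 * N) = j + 4 * N by ring]
      -- Similarly `(T² - 1)² - 4 (T - 1)² = (T - 1)³ (T + 3)`.
      have e : (4 : ℂ) • (x (j + 2 * N) - (2 : ℂ) • x (j + N) + x j) =
          (x (j + 4 * N) - (2 : ℂ) • x (j + 2 * N) + x j)
          - (3 : ℂ) • (x (j + 3 * N) - (3 : ℂ) • x (j + 2 * N) + (3 : ℂ) • x (j + N) - x j)
          - (x (j + 4 * N) - (3 : ℂ) • x (j + 3 * N) + (3 : ℂ) • x (j + 2 * N) - x (j + N)) := by
        module
      have e' := congrArg norm e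
      rw [norm_smul, Complex.norm_ofNat] at e'
      rw [e']
      refine (norm_sub_le_of_le (norm_sub_le_of_le le_rfl
        (norm_smul_le_norm_mul _ b0)) b1).trans ?_
      norm_num
      linarith
  have h1 : ∀ N j, ‖x (j + N) - x j‖ ≤ 4 * (12 * B / (8 - 1)) / (4 - 1) / (2 - 1) := by
    refine le_div_of_doubling (M := 2 * M) (by norm_num) (fun N j => ?_) fun N j => ?_
    · exact (norm_sub_le_of_le (hM _) (hM _)).trans (by linarith)
    · have e : (2 : ℂ) • (x (j + N) - x j) =
          (x (j + 2 * N) - x j) - (x (j + 2 * N) - (2 : ℂ) • x (j + N) + x j) := by module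
      have e' := congrArg norm e
      rw [norm_smul, Complex.norm_ofNat] at e'
      rw [e']
      exact norm_sub_le_of_le le_rfl (by simpa using h2 N j)
  have := h1 1 0
  norm_num at this
  linarith

end Differences

/-! ### The bound for bilinear maps on sequences -/

section Bilinear

variable {A : Type*} [NonUnitalNormedRing A] [NormedSpace ℂ A]
  [IsScalarTower ℂ A A] [SMulCommClass ℂ A A] [CompleteSpace A]
  {X : Type*} [NormedAddCommGroup X] [NormedSpace ℂ X] [CompleteSpace X]
  {φ : A →L[ℂ] A →L[ℂ] X} {α : ℝ}

/-- The twists `fourier n x • p n` and `fourier n x • q n` still satisfy the hypotheses, so the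
bound from `hφ` is uniform in `x` and can be averaged. -/
theorem norm_fourthDiff_le (hα : 0 ≤ α) (hφ : ∀ a b : A, a * b = 0 → ‖φ a b‖ ≤ α * ‖a‖ * ‖b‖)
    {p q r : ℤ → A} {P Q : ℝ} (hp : ∀ n, ‖p n‖ ≤ P) (hq : ∀ n, ‖q n‖ ≤ Q)
    (hpq : ∀ n m, p n * q m = r (n + m)) :
    ‖φ (p 2) (q (-2)) - (4 : ℂ) • φ (p 1) (q (-1)) + (6 : ℂ) • φ (p 0) (q 0)
      - (4 : ℂ) • φ (p (-1)) (q 1) + φ (p (-2)) (q 2)‖ ≤ 108 * (α * P * Q) := by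
  obtain ⟨F, H, hF, hH, hFH, hconv, hdiag⟩ := exists_conv_eq_zero
  have hP : 0 ≤ P := (norm_nonneg _).trans (hp 0)
  have hQ : 0 ≤ Q := (norm_nonneg _).trans (hq 0)
  have hb : ∀ n m, ‖φ (p n) (q m)‖ ≤ ‖φ‖ * P * Q := fun n m =>
    norm_apply_le_of_le φ (hp _) (hq _)
  have key := norm_tsum_antidiagonal_le hF hH hb (K := 108 * (α * P * Q)) fun x => by
    have hfn : ∀ n : ℤ, ‖fourier n x‖ = 1 := fun n => by rw [fourier_apply, Circle.norm_coe]
    have hp' : ∀ n, ‖fourier n x • p n‖ ≤ P := fun n => by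
      rw [norm_smul, hfn, one_mul]; exact hp n
    have hq' : ∀ n, ‖fourier n x • q n‖ ≤ Q := fun n => by
      rw [norm_smul, hfn, one_mul]; exact hq n
    have h0 := tsum_smul_mul_tsum_smul_eq_zero hF hH hconv hp' hq'
      (r := fun n => fourier n x • r n) fun n m => by
        rw [smul_mul_smul_comm, hpq, fourier_add]
    have h1 := hφ _ _ h0
    rw [apply_tsum_tsum φ hF hH hp' hq'] at h1
    have e : ∀ z : ℤ × ℤ, (F z.1 * H z.2) • φ (fourier z.1 x • p z.1) (fourier z.2 x • q z.2) =
        (F z.1 * H z.2 * fourier (z.1 + z.2) x) • φ (p z.1) (q z.2) := fun z => by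
      rw [fourier_add]
      simp only [map_smul, smul_apply, smul_smul]
      congr 1
      ring
    simp only [e] at h1
    refine h1.trans ?_
    calc α * ‖∑' n, F n • fourier n x • p n‖ * ‖∑' n, H n • fourier n x • q n‖
        ≤ α * ((∑' n, ‖F n‖) * P) * ((∑' n, ‖H n‖) * Q) := by
          have := norm_tsum_smul_le hF hp'
          have := norm_tsum_smul_le hH hq'
          gcongr
      _ = ((∑' n, ‖F n‖) * (∑' n, ‖H n‖)) * (α * P * Q) := by ring
      _ ≤ 108 * (α * P * Q) := by gcongr
  rw [tsum_eq_sum (s := {-2, -1, 0, 1, 2})] at key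
  · simp only [hdiag] at key
    norm_num [fourthDiffCoeff] at key
    refine le_of_eq_of_le (congrArg norm ?_) key
    module
  · intro n hn
    simp only [Finset.mem_insert, Finset.mem_singleton, not_or] at hn
    simp [hdiag, fourthDiffCoeff, hn]

/-- If `p n * q m` depends only on `n + m`, then `φ (p 1) (q 0)` is close to `φ (p 0) (q 1)`. -/
theorem norm_apply_sub_apply_le (hα : 0 ≤ α)
    (hφ : ∀ a b : A, a * b = 0 → ‖φ a b‖ ≤ α * ‖a‖ * ‖b‖)
    {p q r : ℤ → A} {P Q : ℝ} (hp : ∀ n, ‖p n‖ ≤ P) (hq : ∀ n, ‖q n‖ ≤ Q)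
    (hpq : ∀ n m, p n * q m = r (n + m)) :
    ‖φ (p 1) (q 0) - φ (p 0) (q 1)‖ ≤ 248 * (α * P * Q) := by
  have hP : 0 ≤ P := (norm_nonneg _).trans (hp 0)
  have hQ : 0 ≤ Q := (norm_nonneg _).trans (hq 0)
  have h := norm_sub_le_of_fourthDiff (x := fun n => φ (p n) (q (1 - n))) (M := ‖φ‖ * P * Q)
    (B := 108 * (α * P * Q))
    (fun n => norm_apply_le_of_le φ (hp _) (hq _))
    (fun N j => by
      -- Sampling along the progression of step `N` centred at `j + 2 N` keeps the product a
      -- function of `n + m`.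
      have := norm_fourthDiff_le hα hφ (p := fun n => p (j + 2 * N + n * N))
        (q := fun n => q (1 - (j + 2 * N) + n * N)) (r := fun n => r (1 + n * N))
        (fun n => hp _) (fun n => hq _) (fun n m => by rw [hpq]; congr 1; ring)
      convert this using 6 <;> ring_nf)
  have h' : 0 ≤ α * P * Q := by positivity
  simp only [sub_self, sub_zero] at h
  -- `16 / 7 * 108 = 1728 / 7 < 248`.
  exact h.trans (by linarith)

end Bilinear

end

end StrongPropertyB

namespace StrongPropertyB

noncomputable section

theorem le_constant : 496 ≤ 288 * Real.pi * (1 + √2) := by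
  have h1 := Real.pi_gt_three
  have h2 := Real.sqrt_nonneg 2
  nlinarith

/-! ### C⋆-algebras -/

section CStar

variable {A : Type*} [NonUnitalCStarAlgebra A]

/-- Multiplication of `a : A` on the right by an element of the unitization. -/
def mulUnitization (a : A) (x : Unitization ℂ A) : A := ((a : Unitization ℂ A) * x).snd

/-- Multiplication of `a : A` on the left by an element of the unitization. -/
def unitizationMul (x : Unitization ℂ A) (a : A) : A := (x * (a : Unitization ℂ A)).snd

theorem coe_mulUnitization (a : A) (x : Unitization ℂ A) :
    ((mulUnitization a x : A) : Unitization ℂ A) = a * x := by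
  ext <;> simp [mulUnitization]

theorem coe_unitizationMul (x : Unitization ℂ A) (a : A) :
    ((unitizationMul x a : A) : Unitization ℂ A) = x * a := by
  ext <;> simp [unitizationMul]

/-- `A` is an isometrically embedded ideal of its unitization, so unitaries exist and act
isometrically even when `A` has no unit. -/
theorem norm_mulUnitization_unitary (a : A) (u : unitary (Unitization ℂ A)) :
    ‖mulUnitization a (u : Unitization ℂ A)‖ = ‖a‖ := by
  rw [← Unitization.norm_inr (𝕜 := ℂ), coe_mulUnitization, CStarRing.norm_mul_coe_unitary,
    Unitization.norm_inr]

theorem norm_unitary_unitizationMul (a : A) (u : unitary (Unitization ℂ A)) :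
    ‖unitizationMul (u : Unitization ℂ A) a‖ = ‖a‖ := by
  rw [← Unitization.norm_inr (𝕜 := ℂ), coe_unitizationMul, CStarRing.norm_coe_unitary_mul,
    Unitization.norm_inr]

theorem mul_eq_sum_mulUnitization {ι : Type*} [Fintype ι] (a b : A) (c : ι → ℂ)
    (x : ι → Unitization ℂ A) (h : (b : Unitization ℂ A) = ∑ i, c i • x i) :
    a * b = ∑ i, c i • mulUnitization a (x i) := by
  apply Unitization.inr_injective (R := ℂ)
  refine Eq.trans ?_ (map_sum (Unitization.inrNonUnitalAlgHom ℂ A)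
    (fun i => c i • mulUnitization a (x i)) Finset.univ).symm
  rw [ Unitization.inr_mul, h, Finset.mul_sum]
  simp [Unitization.inrNonUnitalAlgHom, coe_mulUnitization]

theorem mul_eq_sum_unitizationMul {ι : Type*} [Fintype ι] (a b : A) (c : ι → ℂ)
    (x : ι → Unitization ℂ A) (h : (b : Unitization ℂ A) = ∑ i, c i • x i) :
    b * a = ∑ i, c i • unitizationMul (x i) a := by
  apply Unitization.inr_injective (R := ℂ)
  refine Eq.trans ?_ (map_sum (Unitization.inrNonUnitalAlgHom ℂ A)
    (fun i => c i • unitizationMul (x i) a) Finset.univ).symm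
  rw [ Unitization.inr_mul, h, Finset.sum_mul]
  simp [Unitization.inrNonUnitalAlgHom, coe_unitizationMul]

variable {X : Type*} [NormedAddCommGroup X] [NormedSpace ℂ X] [CompleteSpace X]
  {φ : A →L[ℂ] A →L[ℂ] X} {α : ℝ}

theorem norm_unitary_defect_le (hα : 0 ≤ α)
    (hφ : ∀ a b : A, a * b = 0 → ‖φ a b‖ ≤ α * ‖a‖ * ‖b‖) (a c : A)
    (u : unitary (Unitization ℂ A)) :
    ‖φ (mulUnitization a u) c - φ a (unitizationMul u c)‖ ≤ 248 * (α * ‖a‖ * ‖c‖) := by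
  have h := norm_apply_sub_apply_le hα hφ
    (p := fun n => mulUnitization a (u ^ n : unitary (Unitization ℂ A)))
    (q := fun n => unitizationMul (u ^ n : unitary (Unitization ℂ A)) c)
    (r := fun n => mulUnitization a (u ^ n : unitary (Unitization ℂ A)) * c)
    (fun n => (norm_mulUnitization_unitary a _).le)
    (fun n => (norm_unitary_unitizationMul c _).le)
    (fun n m => by
      apply Unitization.inr_injective (R := ℂ)
      simp only [Unitization.inr_mul, coe_mulUnitization, coe_unitizationMul, zpow_add,
        Submonoid.coe_mul, mul_assoc])
  have h1 : mulUnitization a (1 : Unitization ℂ A) = a := by simp [mulUnitization]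
  have h2 : unitizationMul (1 : Unitization ℂ A) c = c := by simp [unitizationMul]
  simpa [h1, h2] using! h

end CStar

theorem hasStrongPropertyB_cstarAlgebra (A : Type u) [NonUnitalCStarAlgebra A] :
    HasStrongPropertyB.{u, w} A (288 * Real.pi * (1 + √2)) := by
  refine ⟨by positivity, fun X _ _ _ φ α hα hφ a b c => ?_⟩
  -- The four coefficients are at most `‖b‖ / 2`, whence `4 * 248 / 2 = 496`.
  obtain ⟨x, s, hx, hs⟩ := CStarAlgebra.exists_sum_four_unitary (b : Unitization ℂ A)
  rw [Unitization.norm_inr] at hs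
  rw [mul_eq_sum_mulUnitization a b s _ hx, mul_eq_sum_unitizationMul c b s _ hx]
  have e : φ (∑ i, s i • mulUnitization a (x i)) c - φ a (∑ i, s i • unitizationMul (x i) c)
      = ∑ i, s i • (φ (mulUnitization a (x i)) c - φ a (unitizationMul (x i) c)) := by
    simp [map_sum, smul_sub, Finset.sum_sub_distrib]
  rw [e]
  calc _ ≤ ∑ i : Fin 4, ‖b‖ / 2 * (248 * (α * ‖a‖ * ‖c‖)) :=
        norm_sum_le_of_le _ fun i _ => by
          rw [norm_smul]
          exact mul_le_mul (hs i) (norm_unitary_defect_le hα hφ a c (x i)) (norm_nonneg _)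
            (by positivity)
    _ = 496 * (α * ‖a‖ * ‖b‖ * ‖c‖) := by
        simp
        ring
    _ ≤ (288 * Real.pi * (1 + √2)) * (α * ‖a‖ * ‖b‖ * ‖c‖) := by
        gcongr
        exact le_constant
    _ = _ := by ring

end

end StrongPropertyB

namespace L1GroupAlgebra

noncomputable section

open Measure Topology

/-! ### Density and separation in `L¹` -/

section Functional

variable {G : Type*} [TopologicalSpace G] [MeasurableSpace G] [BorelSpace G] {μ : Measure G}

omit [TopologicalSpace G] [BorelSpace G] in
theorem coe_sub (f g : L1GroupAlgebra μ) : ⇑(f - g) =ᵐ[μ] fun x => f x - g x :=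
  Lp.coeFn_sub (p := 1) (μ := μ) f g

omit [TopologicalSpace G] [BorelSpace G] in
theorem norm_sub_eq_integral {f g : L1GroupAlgebra μ} {f' g' : G → ℂ} (hf : f =ᵐ[μ] f')
    (hg : g =ᵐ[μ] g') : ‖f - g‖ = ∫ x, ‖f' x - g' x‖ ∂μ := by
  rw [norm_eq_integral]
  refine integral_congr_ae ?_
  filter_upwards [coe_sub f g, hf, hg] with x h1 h2 h3
  rw [h1, h2, h3]

/-- The element of `L¹` given by an integrable function. -/
def ofIntegrable (g : G → ℂ) (hg : Integrable g μ) : L1GroupAlgebra μ := hg.toL1 g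

omit [TopologicalSpace G] [BorelSpace G] in
theorem coe_ofIntegrable (g : G → ℂ) (hg : Integrable g μ) : ofIntegrable g hg =ᵐ[μ] g :=
  hg.coeFn_toL1

theorem integrable_mul_coe {ψ : G → ℂ} (hψ : Continuous ψ) {M : ℝ} (hM : ∀ x, ‖ψ x‖ ≤ M)
    (f : L1GroupAlgebra μ) : Integrable (fun x => ψ x * f x) μ := by
  have : AEStronglyMeasurable (fun x => ψ x * f x) μ :=
    (hψ.measurable.aestronglyMeasurable).mul (integrable_coe f).aestronglyMeasurable
  refine ((integrable_coe f).norm.const_mul M).mono' this (.of_forall fun x => ?_)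
  rw [norm_mul]
  exact mul_le_mul_of_nonneg_right (hM x) (norm_nonneg _)

/-- Integration against a bounded continuous function. -/
def pairing {ψ : G → ℂ} (hψ : Continuous ψ) {M : ℝ} (hM : ∀ x, ‖ψ x‖ ≤ M) :
    L1GroupAlgebra μ →L[ℂ] ℂ :=
  LinearMap.mkContinuous
    { toFun := fun f => ∫ x, ψ x * f x ∂μ
      map_add' := fun f g => by
        rw [← integral_add (integrable_mul_coe hψ hM f) (integrable_mul_coe hψ hM g)]
        refine integral_congr_ae ?_
        filter_upwards [coe_add f g] with x hx
        rw [hx, mul_add]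
      map_smul' := fun c f => by
        rw [RingHom.id_apply, smul_eq_mul, ← integral_const_mul]
        refine integral_congr_ae ?_
        filter_upwards [coe_smul c f] with x hx
        rw [hx]
        ring } M fun f => by
    rw [norm_eq_integral, ← integral_const_mul]
    refine (norm_integral_le_integral_norm _).trans
      (integral_mono (integrable_mul_coe hψ hM f).norm ((integrable_coe f).norm.const_mul M)
        fun x => ?_)
    simp only [norm_mul]
    exact mul_le_mul_of_nonneg_right (hM x) (norm_nonneg _)

theorem pairing_apply {ψ : G → ℂ} (hψ : Continuous ψ) {M : ℝ} (hM : ∀ x, ‖ψ x‖ ≤ M)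
    (f : L1GroupAlgebra μ) : pairing hψ hM f = ∫ x, ψ x * f x ∂μ := rfl

theorem norm_pairing_le {ψ : G → ℂ} (hψ : Continuous ψ) {M : ℝ} (hM : ∀ x, ‖ψ x‖ ≤ M)
    (hM0 : 0 ≤ M) (f : L1GroupAlgebra μ) : ‖pairing hψ hM f‖ ≤ M * ‖f‖ :=
  (pairing hψ hM).le_of_opNorm_le (LinearMap.mkContinuous_norm_le _ hM0 _) f

/-- The elements of `L¹` that have a continuous representative with compact support. -/
def compactlySupported (μ : Measure G) : Set (L1GroupAlgebra μ) :=
  {f | ∃ g : G → ℂ, Continuous g ∧ HasCompactSupport g ∧ f =ᵐ[μ] g}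

/-- Regularity gives a compact `s ⊆ t` and an open `U ⊇ s` with `t \ s` and `U \ s` small. A Urysohn
function for `s ⊆ U`, times `c`, differs from the indicator only on these two sets. -/
theorem exists_hasCompactSupport_eLpNorm_indicator_sub_le [R1Space G] [LocallyCompactSpace G]
    [μ.Regular] (c : ℂ) {t : Set G} (ht : MeasurableSet t) (htμ : μ t < ⊤) {ε : ENNReal}
    (hε : ε ≠ 0) : ∃ g : G → ℂ, eLpNorm (g - t.indicator fun _ => c) 1 μ ≤ ε ∧
      Continuous g ∧ HasCompactSupport g := by
  set η : ENNReal := ε / (2 * (‖c‖ₑ + 1)) with hη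
  have hη0 : η ≠ 0 := ENNReal.div_ne_zero.2 ⟨hε, by finiteness⟩
  obtain ⟨s, hst, hsc, hscl, hsμ⟩ := ht.exists_isCompact_isClosed_sdiff_lt htμ.ne hη0
  obtain ⟨U, hsU, hU, -, hUμ⟩ :=
    hscl.measurableSet.exists_isOpen_sdiff_lt (μ := μ) hsc.measure_ne_top hη0
  obtain ⟨f, hf1, hfc, hfU, hf01⟩ := exists_continuousMap_one_of_isCompact_subset_isOpen hsc hU hsU
  refine ⟨fun x => (f x : ℂ) * c, ?_, by fun_prop, ?_⟩
  · rw [eLpNorm_one_eq_lintegral_enorm]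
    have hle : ∀ x, ‖((fun x => (f x : ℂ) * c) - t.indicator fun _ => c) x‖ₑ ≤
        (U \ s).indicator (fun _ => ‖c‖ₑ) x + (t \ s).indicator (fun _ => ‖c‖ₑ) x := fun x => by
      by_cases hxs : x ∈ s
      · have h1 : f x = 1 := hf1 hxs
        simp [hst hxs, h1]
      · rw [Pi.sub_apply, sub_eq_add_neg]
        refine (enorm_add_le _ _).trans (add_le_add ?_ ?_)
        · by_cases hxU : x ∈ U
          · rw [Set.indicator_of_mem (s := U \ s) ⟨hxU, hxs⟩, enorm_mul]
            refine mul_le_of_le_one_left' ?_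
            rw [← ofReal_norm, Complex.norm_real, Real.norm_of_nonneg (hf01 x).1]
            exact ENNReal.ofReal_le_one.2 (hf01 x).2
          · have h0 : f x = 0 := image_eq_zero_of_notMem_tsupport fun h => hxU (hfU h)
            simp [h0]
        · rw [enorm_neg]
          by_cases hxt : x ∈ t
          · rw [Set.indicator_of_mem hxt, Set.indicator_of_mem (s := t \ s) ⟨hxt, hxs⟩]
          · simp [hxt]
    have hm1 : MeasurableSet (U \ s) := hU.measurableSet.diff hscl.measurableSet
    have hm2 : MeasurableSet (t \ s) := ht.diff hscl.measurableSet
    refine (lintegral_mono hle).trans ?_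
    rw [lintegral_add_left (measurable_const.indicator hm1), lintegral_indicator_const hm1,
      lintegral_indicator_const hm2, ← mul_add]
    calc ‖c‖ₑ * (μ (U \ s) + μ (t \ s)) ≤ (‖c‖ₑ + 1) * (η + η) := by gcongr; exact le_self_add
      _ = η * (2 * (‖c‖ₑ + 1)) := by ring
      _ ≤ ε := (ENNReal.div_mul_cancel (by simp) (by finiteness)).le
  · exact HasCompactSupport.mul_right (f := fun x => (f x : ℂ))
      (HasCompactSupport.comp_left (g := fun r : ℝ => (r : ℂ)) hfc Complex.ofReal_zero)

theorem dense_compactlySupported [R1Space G] [LocallyCompactSpace G] [μ.Regular] :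
    Dense (compactlySupported μ) := by
  rw [Metric.dense_iff]
  intro f ε hε
  obtain ⟨g, hgε, hgc, hgs⟩ := (memLp_one_iff_integrable.2 (integrable_coe f)).induction_dense
    ENNReal.one_ne_top (fun g => Continuous g ∧ HasCompactSupport g)
    (fun c s hs hμs _ hε => exists_hasCompactSupport_eLpNorm_indicator_sub_le c hs hμs hε)
    (fun _ _ h1 h2 => ⟨h1.1.add h2.1, h1.2.add h2.2⟩)
    (fun _ h => h.1.measurable.aestronglyMeasurable)
    (ε := ENNReal.ofReal (ε / 2)) (by simpa using hε)
  have hgi : Integrable g μ := hgc.integrable_of_hasCompactSupport hgs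
  refine ⟨ofIntegrable g hgi, ?_, g, hgc, hgs, coe_ofIntegrable g hgi⟩
  rw [Metric.mem_ball', dist_eq_norm, norm_sub_eq_integral (f' := f) Filter.EventuallyEq.rfl
    (coe_ofIntegrable g hgi)]
  refine lt_of_le_of_lt ?_ (half_lt_self hε)
  refine (integral_norm_eq_lintegral_enorm
    ((integrable_coe f).sub hgi).aestronglyMeasurable).trans_le ?_
  rw [eLpNorm_one_eq_lintegral_enorm] at hgε
  exact ENNReal.toReal_le_of_le_ofReal (half_pos hε).le hgε

/-- Approximate `f` by `k` with a continuous compactly supported representative `g`, and test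
against a continuous substitute for the conjugate phase of `g`. -/
theorem eq_zero_of_pairing_eq_zero [R1Space G] [LocallyCompactSpace G] [μ.Regular]
    {f : L1GroupAlgebra μ}
    (h : ∀ (ψ : G → ℂ) (hψ : Continuous ψ) (hM : ∀ x, ‖ψ x‖ ≤ 1), pairing hψ hM f = 0) :
    f = 0 := by
  rw [← norm_le_zero_iff]
  refine le_of_forall_pos_le_add fun ε hε => ?_
  obtain ⟨k, ⟨g, hgc, hgs, hkg⟩, hfk⟩ :=
    (dense_compactlySupported (μ := μ)).exists_dist_lt f (ε := ε / 3) (by positivity)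
  rw [dist_eq_norm] at hfk
  have hK : μ (tsupport g) ≠ ⊤ := hgs.measure_ne_top
  set m := μ.real (tsupport g) with hm
  set δ := ε / (3 * (m + 1)) with hδ
  have hm0 : 0 ≤ m := measureReal_nonneg
  have hδ0 : 0 < δ := by positivity
  have hδm : δ * m ≤ ε / 3 := by
    rw [hδ, div_mul_eq_mul_div, div_le_div_iff₀ (by positivity) (by positivity)]
    nlinarith
  have hpos : ∀ x, (0 : ℝ) < ‖g x‖ + δ := fun x => by positivity
  -- The shift by `δ` avoids division by zero; it costs at most `δ` at each point of the support of
  -- `g`, hence at most `δ m ≤ ε / 3` in the integral.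
  let ψ : G → ℂ := fun x => (starRingEnd ℂ) (g x) / ((‖g x‖ + δ : ℝ) : ℂ)
  have hψ : Continuous ψ := by
    refine (Complex.continuous_conj.comp hgc).div (by fun_prop) fun x => ?_
    exact_mod_cast (hpos x).ne'
  have hM : ∀ x, ‖ψ x‖ ≤ 1 := fun x => by
    simp only [ψ, norm_div, RCLike.norm_conj, Complex.norm_real, Real.norm_eq_abs,
      abs_of_pos (hpos x)]
    rw [div_le_one (hpos x)]
    linarith
  have h1 : ‖pairing hψ hM k‖ ≤ ε / 3 := by
    have : pairing hψ hM k = -pairing hψ hM (f - k) := by rw [map_sub, h ψ hψ hM]; simp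
    rw [this, norm_neg]
    exact (norm_pairing_le hψ hM zero_le_one _).trans (by linarith)
  have h2 : pairing hψ hM k = ((∫ x, ‖g x‖ ^ 2 / (‖g x‖ + δ) ∂μ : ℝ) : ℂ) := by
    rw [pairing_apply, ← integral_complex_ofReal]
    refine integral_congr_ae ?_
    filter_upwards [hkg] with x hx
    rw [hx]
    simp only [ψ]
    rw [div_mul_eq_mul_div, Complex.conj_mul']
    push_cast
    rfl
  have hgi : Integrable g μ := hgc.integrable_of_hasCompactSupport hgs
  have hk : ‖k‖ = ∫ x, ‖g x‖ ∂μ := by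
    rw [norm_eq_integral]
    refine integral_congr_ae ?_
    filter_upwards [hkg] with x hx
    rw [hx]
  have hqi : Integrable (fun x => ‖g x‖ ^ 2 / (‖g x‖ + δ)) μ := by
    refine hgi.norm.mono' ?_ (.of_forall fun x => ?_)
    · exact ((hgc.norm.pow 2).div (hgc.norm.add continuous_const)
        fun x => (hpos x).ne').measurable.aestronglyMeasurable
    · rw [Real.norm_of_nonneg (div_nonneg (sq_nonneg _) (hpos x).le), div_le_iff₀ (hpos x)]
      nlinarith [norm_nonneg (g x)]
  have h3 : ∫ x, ‖g x‖ ∂μ ≤ (∫ x, ‖g x‖ ^ 2 / (‖g x‖ + δ) ∂μ) + δ * m := by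
    have hi : Integrable ((tsupport g).indicator fun _ => δ) μ :=
      (integrable_indicator_iff (isClosed_tsupport g).measurableSet).2 (integrableOn_const hK)
    have e : δ * m = ∫ x, (tsupport g).indicator (fun _ => δ) x ∂μ := by
      rw [integral_indicator (isClosed_tsupport g).measurableSet, setIntegral_const, smul_eq_mul,
        mul_comm]
    rw [e, ← integral_add hqi hi]
    refine integral_mono hgi.norm (hqi.add hi) fun x => ?_
    by_cases hx : x ∈ tsupport g
    · simp only [hx, Set.indicator_of_mem]
      rw [← _root_.sub_le_iff_le_add, le_div_iff₀ (hpos x)]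
      nlinarith [norm_nonneg (g x), sq_nonneg δ]
    · simp [hx, image_eq_zero_of_notMem_tsupport hx]
  have h4 : 0 ≤ ∫ x, ‖g x‖ ^ 2 / (‖g x‖ + δ) ∂μ :=
    integral_nonneg fun x => div_nonneg (sq_nonneg _) (hpos x).le
  rw [h2, Complex.norm_real, Real.norm_of_nonneg h4] at h1
  have h5 : ‖f‖ ≤ ‖f - k‖ + ‖k‖ := by simpa using norm_add_le (f - k) k
  rw [hk] at h5
  linarith

end Functional

end

end L1GroupAlgebra

namespace L1GroupAlgebra

noncomputable section

open Measure Topology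
open scoped Pointwise

/-! ### Right translation and the modular function -/

section RightTranslation

variable {G : Type*} [Group G] [TopologicalSpace G] [IsTopologicalGroup G]
  [LocallyCompactSpace G] [MeasurableSpace G] [BorelSpace G]
  {μ : Measure G} [μ.IsHaarMeasure] [μ.Regular]

variable (μ) in
theorem map_mul_right_eq_smul (y : G) : map (· * y) μ = modularCharacterFun y • μ := by
  rw [modularCharacterFun_eq_haarScalarFactor μ y]
  have : (map (· * y) μ).Regular := Regular.map (Homeomorph.mulRight y)
  exact isMulLeftInvariant_eq_smul_of_regular _ μ

theorem integral_mul_right_eq_smul {E : Type*} [NormedAddCommGroup E] [NormedSpace ℝ E]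
    (g : G → E) (y : G) :
    ∫ x, g (x * y) ∂μ = (modularCharacterFun y : ℝ) • ∫ x, g x ∂μ := by
  have h := integral_map_equiv (μ := μ) (MeasurableEquiv.mulRight y) g
  simp only [MeasurableEquiv.coe_mulRight] at h
  rw [← h, map_mul_right_eq_smul, integral_smul_nnreal_measure]
  rfl

theorem integrable_comp_mul_right {g : G → ℂ} (hg : Integrable g μ) (y : G) :
    Integrable (fun x => g (x * y)) μ := by
  refine (integrable_map_equiv (MeasurableEquiv.mulRight y) g).1 ?_
  rw [MeasurableEquiv.coe_mulRight, map_mul_right_eq_smul]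
  exact hg.smul_measure_nnreal

theorem ae_comp_mul_right {p : G → Prop} (hp : ∀ᵐ x ∂μ, p x) (y : G) : ∀ᵐ x ∂μ, p (x * y) := by
  have h : QuasiMeasurePreserving (· * y) μ μ := by
    refine ⟨measurable_mul_const y, ?_⟩
    rw [map_mul_right_eq_smul]
    exact smul_absolutelyContinuous
  exact h.ae hp

omit [MeasurableSpace G] [BorelSpace G] in
theorem modularCharacterFun_mul_inv (y : G) :
    (modularCharacterFun y : ℝ) * modularCharacterFun y⁻¹ = 1 := by
  rw [← NNReal.coe_mul, ← modularCharacterFun_map_mul, mul_inv_cancel, modularCharacterFun_map_one,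
    NNReal.coe_one]

omit [LocallyCompactSpace G] [MeasurableSpace G] [BorelSpace G] in
theorem exists_isCompact_forall_comp_mul_right {g : G → ℂ} (hg : HasCompactSupport g)
    {V : Set G} (hV : IsCompact V) : ∃ K, IsCompact K ∧ ∀ y ∈ V, ∀ x ∉ K, g (x * y) = 0 := by
  refine ⟨tsupport g * V⁻¹, hg.isCompact.mul hV.inv, fun y hy x hx => ?_⟩
  refine image_eq_zero_of_notMem_tsupport fun h => hx ?_
  exact ⟨x * y, h, y⁻¹, by simpa using hy, by simp⟩

omit [MeasurableSpace G] [BorelSpace G] in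
-- `Δ(y)` is the ratio of `∫ f (x y)` to `∫ f` for a bump function `f`. For `y` near a given point
-- the integrands vanish off one compact set, so the integral is continuous in `y`.
theorem continuous_modularCharacterFun :
    Continuous fun y : G => (modularCharacterFun y : ℝ) := by
  borelize G
  let ν : Measure G := haar
  obtain ⟨⟨f, f_cont⟩, f_comp, f_nonneg, f_one⟩ :
    ∃ f : C(G, ℝ), HasCompactSupport f ∧ 0 ≤ f ∧ f 1 ≠ 0 := exists_continuous_nonneg_pos 1
  have hf : ∫ x, f x ∂ν ≠ 0 :=
    ne_of_gt (f_cont.integral_pos_of_hasCompactSupport_nonneg_nonzero f_comp f_nonneg f_one)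
  have e : (fun y : G => (modularCharacterFun y : ℝ)) =
      fun y => (∫ x, f (x * y) ∂ν) / ∫ x, f x ∂ν := by
    funext y
    rw [integral_mul_right_eq_smul, smul_eq_mul, mul_div_cancel_right₀ _ hf]
  rw [e]
  refine Continuous.div_const ?_ _
  rw [continuous_iff_continuousAt]
  intro y₀
  obtain ⟨V, hV, hVy⟩ := exists_compact_mem_nhds y₀
  have hs : HasCompactSupport fun x => (f x : ℂ) :=
    HasCompactSupport.comp_left (g := fun r : ℝ => (r : ℂ)) f_comp Complex.ofReal_zero
  obtain ⟨K, hK, hK0⟩ := exists_isCompact_forall_comp_mul_right hs hV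
  have f_cont' : Continuous f := f_cont
  refine ContinuousOn.continuousAt (s := V) ?_ hVy
  refine continuousOn_integral_of_compact_support hK ?_ fun y x hy hx => ?_
  · exact (f_cont'.comp (continuous_snd.mul continuous_fst)).continuousOn
  · exact_mod_cast hK0 y hy x hx

/-- Right translation `(R_y f)(x) = Δ(y) f (x y⁻¹)`, the convolution with the point mass at `y`
from the right. -/
def rightTranslate (y : G) (f : L1GroupAlgebra μ) : L1GroupAlgebra μ :=
  ofIntegrable (fun x => (modularCharacterFun y : ℂ) * f (x * y⁻¹))
    ((integrable_comp_mul_right (integrable_coe f) y⁻¹).const_mul _)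

theorem rightTranslate_ae (y : G) (f : L1GroupAlgebra μ) :
    rightTranslate y f =ᵐ[μ] fun x => (modularCharacterFun y : ℂ) * f (x * y⁻¹) :=
  coe_ofIntegrable _ _

theorem norm_rightTranslate (y : G) (f : L1GroupAlgebra μ) : ‖rightTranslate y f‖ = ‖f‖ := by
  have h : ‖rightTranslate y f‖ = ∫ x, ‖(modularCharacterFun y : ℂ) * f (x * y⁻¹)‖ ∂μ := by
    rw [norm_eq_integral]
    refine integral_congr_ae ?_
    filter_upwards [rightTranslate_ae y f] with x hx
    rw [hx]
  simp only [norm_mul] at h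
  rw [h, integral_const_mul, integral_mul_right_eq_smul (fun x => ‖f x‖), norm_eq_integral f,
    smul_eq_mul, ← mul_assoc]
  simp [modularCharacterFun_mul_inv]

theorem rightTranslate_one (f : L1GroupAlgebra μ) : rightTranslate 1 f = f := by
  refine Lp.ext (p := 1) (μ := μ) ?_
  refine (rightTranslate_ae 1 f).trans (.of_forall fun x => ?_)
  simp [modularCharacterFun_map_one]

/-- The weight `Δ(y)` cancels the factor `Δ(y⁻¹)` produced by the change of variables. -/
theorem integral_rightTranslate_smul {E : Type*} [NormedAddCommGroup E] [NormedSpace ℂ E]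
    (y : G) (f : L1GroupAlgebra μ) (k : G → E) :
    ∫ x, rightTranslate y f x • k x ∂μ = ∫ x, f x • k (x * y) ∂μ := by
  have h1 : ∫ x, rightTranslate y f x • k x ∂μ =
      ∫ x, (fun z => (modularCharacterFun y : ℂ) • (f z • k (z * y))) (x * y⁻¹) ∂μ := by
    refine integral_congr_ae ?_
    filter_upwards [rightTranslate_ae y f] with x hx
    simp only [hx, inv_mul_cancel_right, mul_smul]
  refine h1.trans ((integral_mul_right_eq_smul (μ := μ)
    (fun z => (modularCharacterFun y : ℂ) • (f z • k (z * y))) y⁻¹).trans ?_)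
  rw [integral_smul]
  have h2 : ∀ v : E, (modularCharacterFun y⁻¹ : ℝ) • (modularCharacterFun y : ℂ) • v = v :=
    fun v => by
      have := modularCharacterFun_mul_inv y
      rw [← Complex.coe_smul, smul_smul, ← Complex.ofReal_mul, mul_comm, this,
        Complex.ofReal_one, one_smul]
  exact h2 _

/-- The point mass at `y` moves across the product. This makes `rightTranslate (y ^ n) a * translate
(y ^ m) c` depend only on `n + m`. -/
theorem rightTranslate_conv (y : G) (f c : L1GroupAlgebra μ) :
    rightTranslate y f * c = f * translate y c := by
  rw [mul_def, mul_def, integral_rightTranslate_smul]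
  simp only [translate_mul]

theorem continuous_rightTranslate {f : L1GroupAlgebra μ} (hf : f ∈ compactlySupported μ) :
    Continuous fun y => rightTranslate y f := by
  obtain ⟨g, hgc, hgs, hfg⟩ := hf
  have hae : ∀ y, rightTranslate y f =ᵐ[μ] fun x => (modularCharacterFun y : ℂ) * g (x * y⁻¹) :=
    fun y => by
      filter_upwards [rightTranslate_ae y f, ae_comp_mul_right hfg y⁻¹] with x h1 h2
      rw [h1, h2]
  rw [continuous_iff_continuousAt]
  intro y₀
  rw [ContinuousAt, tendsto_iff_norm_sub_tendsto_zero]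
  simp only [fun y => norm_sub_eq_integral (hae y) (hae y₀)]
  obtain ⟨V, hV, hVy⟩ := exists_compact_mem_nhds y₀
  obtain ⟨K, hK, hK0⟩ := exists_isCompact_forall_comp_mul_right hgs hV.inv
  have hc : ContinuousOn (fun y => ∫ x, ‖(modularCharacterFun y : ℂ) * g (x * y⁻¹) -
      (modularCharacterFun y₀ : ℂ) * g (x * y₀⁻¹)‖ ∂μ) V := by
    refine continuousOn_integral_of_compact_support hK ?_ fun y x hy hx => ?_
    · have h1 : Continuous fun y : G => ((modularCharacterFun y : ℝ) : ℂ) :=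
        Complex.continuous_ofReal.comp continuous_modularCharacterFun
      have h2 : Continuous fun z : G × G => ‖((modularCharacterFun z.1 : ℝ) : ℂ) *
          g (z.2 * z.1⁻¹) - (modularCharacterFun y₀ : ℂ) * g (z.2 * y₀⁻¹)‖ :=
        (((h1.comp continuous_fst).mul (hgc.comp
          (continuous_snd.mul continuous_fst.inv))).sub (continuous_const.mul
            (hgc.comp (continuous_snd.mul continuous_const)))).norm
      exact h2.continuousOn
    · rw [hK0 _ (by simpa using hy) x hx, hK0 _ (by simpa using mem_of_mem_nhds hVy) x hx]
      simp
  have := hc.continuousAt hVy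
  simpa [ContinuousAt] using this

omit [LocallyCompactSpace G] [μ.Regular] in
theorem pairing_translate {ψ : G → ℂ} (hψ : Continuous ψ) {M : ℝ} (hM : ∀ x, ‖ψ x‖ ≤ M) (y : G)
    (f : L1GroupAlgebra μ) : pairing hψ hM (translate y f) = ∫ x, ψ (y * x) * f x ∂μ := by
  have h : pairing hψ hM (translate y f) =
      ∫ x, (fun z => ψ (y * z) * f z) (y⁻¹ * x) ∂μ := by
    rw [pairing_apply]
    refine integral_congr_ae ?_
    filter_upwards [translate_ae y f] with x hx
    simp only [hx, mul_inv_cancel_left]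
  exact h.trans (integral_mul_left_eq_self (fun z => ψ (y * z) * f z) y⁻¹)

theorem pairing_rightTranslate {ψ : G → ℂ} (hψ : Continuous ψ) {M : ℝ} (hM : ∀ x, ‖ψ x‖ ≤ M)
    (y : G) (f : L1GroupAlgebra μ) :
    pairing hψ hM (rightTranslate y f) = ∫ x, ψ (x * y) * f x ∂μ := by
  have h := integral_rightTranslate_smul y f ψ
  simp only [smul_eq_mul] at h
  simp only [pairing_apply, mul_comm (ψ _)]
  exact h

theorem integrable_smul_rightTranslate {a b : L1GroupAlgebra μ} (ha : a ∈ compactlySupported μ)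
    (hb : b ∈ compactlySupported μ) : Integrable (fun y => b y • rightTranslate y a) μ := by
  obtain ⟨g, hgc, hgs, hbg⟩ := hb
  have h : Integrable (fun y => g y • rightTranslate y a) μ :=
    (hgc.smul (continuous_rightTranslate ha)).integrable_of_hasCompactSupport hgs.smul_right
  refine h.congr ?_
  filter_upwards [hbg] with y hy
  rw [hy]

/-- Convolution as an integral of right translates. -/
theorem mul_eq_integral_rightTranslate {a b : L1GroupAlgebra μ} (ha : a ∈ compactlySupported μ)
    (hb : b ∈ compactlySupported μ) : a * b = ∫ y, b y • rightTranslate y a ∂μ := by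
  rw [← sub_eq_zero]
  refine eq_zero_of_pairing_eq_zero fun ψ hψ hM => ?_
  have hinteg := integrable_smul_rightTranslate ha hb
  obtain ⟨f, hfc, hfs, haf⟩ := ha
  obtain ⟨g, hgc, hgs, hbg⟩ := hb
  have h1 : pairing hψ hM (a * b) = ∫ x, ∫ y, f x * g y * ψ (x * y) ∂μ ∂μ := by
    rw [mul_def, ← (pairing hψ hM).integral_comp_comm (integrable_smul_translate a b)]
    refine integral_congr_ae ?_
    filter_upwards [haf] with x hx
    rw [map_smul, pairing_translate, hx, smul_eq_mul, ← integral_const_mul]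
    refine integral_congr_ae ?_
    filter_upwards [hbg] with y hy
    rw [hy]
    ring
  have h2 : pairing hψ hM (∫ y, b y • rightTranslate y a ∂μ) =
      ∫ y, ∫ x, f x * g y * ψ (x * y) ∂μ ∂μ := by
    rw [← (pairing hψ hM).integral_comp_comm hinteg]
    refine integral_congr_ae ?_
    filter_upwards [hbg] with y hy
    rw [map_smul, pairing_rightTranslate, hy, smul_eq_mul, ← integral_const_mul]
    refine integral_congr_ae ?_
    filter_upwards [haf] with x hx
    rw [hx]
    ring
  rw [map_sub, h1, h2, sub_eq_zero]
  -- `μ` need not be σ-finite; the interchange rests on the integrand being continuous with compact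
  -- support, which is why `a` and `b` are restricted.
  refine integral_integral_swap_of_hasCompactSupport (f := fun x y => f x * g y * ψ (x * y)) ?_ ?_
  · exact ((hfc.comp continuous_fst).mul (hgc.comp continuous_snd)).mul
      (hψ.comp (continuous_fst.mul continuous_snd))
  · refine HasCompactSupport.intro (hfs.isCompact.prod hgs.isCompact) fun z hz => ?_
    rw [Set.mem_prod, not_and_or] at hz
    rcases hz with hz | hz <;> simp [Function.uncurry, image_eq_zero_of_notMem_tsupport hz]

end RightTranslation

end

end L1GroupAlgebra

namespace StrongPropertyB

open L1GroupAlgebra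

/-! ### Group algebras -/

section Group

variable {G : Type*} [Group G] [TopologicalSpace G] [IsTopologicalGroup G]
  [LocallyCompactSpace G] [MeasurableSpace G] [BorelSpace G]
  {μ : Measure G} [μ.IsHaarMeasure] [μ.Regular]
  {X : Type*} [NormedAddCommGroup X] [NormedSpace ℂ X] [CompleteSpace X]
  {φ : L1GroupAlgebra μ →L[ℂ] L1GroupAlgebra μ →L[ℂ] X} {α : ℝ}

theorem norm_translate_defect_le (hα : 0 ≤ α)
    (hφ : ∀ a b : L1GroupAlgebra μ, a * b = 0 → ‖φ a b‖ ≤ α * ‖a‖ * ‖b‖)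
    (a c : L1GroupAlgebra μ) (y : G) :
    ‖φ (rightTranslate y a) c - φ a (translate y c)‖ ≤ 248 * (α * ‖a‖ * ‖c‖) := by
  have h1 : translate (μ := μ) 1 c = c := by
    have := translate_mul (μ := μ) 1 1 c
    rw [one_mul] at this
    exact ((L1GroupAlgebra.translate 1).injective this).symm
  have h := norm_apply_sub_apply_le hα hφ
    (p := fun n => rightTranslate (y ^ n) a) (q := fun n => translate (y ^ n) c)
    (r := fun n => a * translate (y ^ n) c)
    (fun n => (norm_rightTranslate _ a).le) (fun n => ((L1GroupAlgebra.translate _).norm_map c).le)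
    (fun n m => by rw [rightTranslate_conv, zpow_add, translate_mul])
  simpa only [zpow_one, zpow_zero, rightTranslate_one, h1] using h

/-- Both `a * b` and `b * c` are integrals against `b y`, of right translates of `a` and left
translates of `c`. So the defect is the `b`-weighted integral of the point-mass defects. -/
theorem norm_defect_le_of_compactlySupported (hα : 0 ≤ α)
    (hφ : ∀ a b : L1GroupAlgebra μ, a * b = 0 → ‖φ a b‖ ≤ α * ‖a‖ * ‖b‖)
    {a b : L1GroupAlgebra μ} (ha : a ∈ compactlySupported μ) (hb : b ∈ compactlySupported μ)
    (c : L1GroupAlgebra μ) :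
    ‖φ (a * b) c - φ a (b * c)‖ ≤ 248 * (α * ‖a‖ * ‖b‖ * ‖c‖) := by
  have i1 := integrable_smul_rightTranslate ha hb
  have i2 := integrable_smul_translate b c
  have h1 : φ (a * b) c = ∫ y, φ (b y • rightTranslate y a) c ∂μ := by
    rw [mul_eq_integral_rightTranslate ha hb]
    exact ((φ.flip c).integral_comp_comm i1).symm
  have h2 : φ a (b * c) = ∫ y, φ a (b y • translate y c) ∂μ := by
    rw [mul_def]
    exact ((φ a).integral_comp_comm i2).symm
  have i3 : Integrable (fun y => φ (b y • rightTranslate y a) c) μ :=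
    (φ.flip c).integrable_comp i1
  have i4 : Integrable (fun y => φ a (b y • translate y c)) μ := (φ a).integrable_comp i2
  rw [h1, h2, ← integral_sub i3 i4]
  have h3 : ∀ y, ‖φ (b y • rightTranslate y a) c - φ a (b y • translate y c)‖ ≤
      ‖b y‖ * (248 * (α * ‖a‖ * ‖c‖)) := fun y => by
    have e : φ (b y • rightTranslate y a) c - φ a (b y • translate y c) =
        b y • (φ (rightTranslate y a) c - φ a (translate y c)) := by simp [smul_sub]
    rw [e, norm_smul]
    exact mul_le_mul_of_nonneg_left (norm_translate_defect_le hα hφ a c y) (norm_nonneg _)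
  refine (norm_integral_le_of_norm_le ((integrable_coe b).norm.mul_const _)
    (.of_forall h3)).trans_eq ?_
  rw [integral_mul_const, ← norm_eq_integral]
  ring

/-- Both sides are continuous in `(a, b)`, so density suffices. -/
theorem norm_defect_le (hα : 0 ≤ α)
    (hφ : ∀ a b : L1GroupAlgebra μ, a * b = 0 → ‖φ a b‖ ≤ α * ‖a‖ * ‖b‖)
    (a b c : L1GroupAlgebra μ) :
    ‖φ (a * b) c - φ a (b * c)‖ ≤ 248 * (α * ‖a‖ * ‖b‖ * ‖c‖) := by
  refine isClosed_property2 (e := fun f : compactlySupported μ => (f : L1GroupAlgebra μ))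
    (p := fun a b => ‖φ (a * b) c - φ a (b * c)‖ ≤ 248 * (α * ‖a‖ * ‖b‖ * ‖c‖))
    dense_compactlySupported.denseRange_val ?_
    (fun a b => norm_defect_le_of_compactlySupported hα hφ a.2 b.2 c) a b
  exact isClosed_le (by fun_prop) (by fun_prop)

end Group

theorem hasStrongPropertyB_groupAlgebra (G : Type v) [Group G] [TopologicalSpace G]
    [IsTopologicalGroup G] [LocallyCompactSpace G] [MeasurableSpace G] [BorelSpace G]
    (μ : Measure G) [μ.IsHaarMeasure] [μ.Regular] :
    HasStrongPropertyB.{v, w} (L1GroupAlgebra μ) (288 * Real.pi * (1 + √2)) := by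
  refine ⟨by positivity, fun X _ _ _ φ α hα hφ a b c => (norm_defect_le hα hφ a b c).trans ?_⟩
  calc 248 * (α * ‖a‖ * ‖b‖ * ‖c‖) ≤ (288 * Real.pi * (1 + √2)) * (α * ‖a‖ * ‖b‖ * ‖c‖) := by
        gcongr
        exact le_trans (by norm_num) le_constant
    _ = _ := by ring

end StrongPropertyB

theorem mainTheorem2 :
    (∀ (A : Type u) [NonUnitalCStarAlgebra A],
      HasStrongPropertyB.{u, w} A (288 * Real.pi * (1 + Real.sqrt 2))) ∧
    (∀ (G : Type v) [Group G] [TopologicalSpace G] [IsTopologicalGroup G]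
      [LocallyCompactSpace G] [T2Space G] [MeasurableSpace G] [BorelSpace G]
      (μ : Measure G) [μ.IsHaarMeasure] [μ.Regular],
      HasStrongPropertyB.{v, w} (L1GroupAlgebra μ) (288 * Real.pi * (1 + Real.sqrt 2))) :=
  ⟨fun A _ => StrongPropertyB.hasStrongPropertyB_cstarAlgebra A,
    fun G _ _ _ _ _ _ _ μ _ _ => StrongPropertyB.hasStrongPropertyB_groupAlgebra G μ⟩
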